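/- Let $\mathcal H$ be a complex Hilbert space, $\mathbb T$ the unit circle, and let $\mu$ be a positive operator-valued measure on $\mathbb T$: a map from the Borel sets to $\mathcal L(\mathcal H)$ such that $\mu_h(\sigma)=\langle\mu(\sigma)h,h\rangle$ is a finite positive Borel measure for every $h\in\mathcal H$. Its moments $\mu_j=\int_{\mathbb T}e^{-ij\theta}\,d\mu(\theta)\in\mathcal L(\mathcal H)$, $j\in\mathbb Z$, are determined by $\langle\mu_jh,h\rangle=\int e^{-ij\theta}\,d\mu_h(\theta)$. Assume that $\mu$ is nontrivial, in the sense that for every $N$ there is $c_N>0$ with $$\sum_{i,j=0}^{N-1}\langle\mu_{i-j}v_j,v_i\rangle\ \ge\ c_N\sum_{j=0}^{N-1}\|v_j\|^2\qquad(v_0,\dots,v_{N-1}\in\mathcal H).$$ Put $T^R_n=(\mu_{i-j})_{0\le i,j<n}$, $T^L_n=(\mu_{j-i})_{0\le i,j<n}$, and let $\nu_n=(\mu_{-n},\dots,\mu_{-1})^{T}$ and $\xi_n=(\mu_n,\dots,\mu_1)^{T}$ (block columns). Define $$\kappa^R_n=\mu_0-\nu_n^\dagger(T^R_n)^{-1}\nu_n,\qquad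 \kappa^L_n=\mu_0-\xi_n^\dagger(T^L_n)^{-1}\xi_n,$$ $$\Phi^R_n(z)=z^nI-[I\ zI\cdots z^{n-1}I](T^R_n)^{-1}\nu_n,\qquad \Phi^L_n(z)=z^nI-[\mu_{-n}\cdots\mu_{-1}](T^L_n)^{-1}[I\ zI\cdots z^{n-1}I]^{T},$$ $$\varphi^R_n=\Phi^R_n(\kappa^R_n)^{-1/2},$$ $$\alpha^R_n=-\big((\kappa^R_n)^{-1/2}\big)^\dagger\,\Phi^R_{n+1}(0)^\dagger(\kappa^L_n)^{1/2},\qquad \alpha^L_n=-(\kappa^R_n)^{1/2}\,\Phi^L_{n+1}(0)^\dagger\big((\kappa^L_n)^{-1/2}\big)^\dagger .$$ The $\varphi_n^R$ are the right orthogonal polynomials of $\mu$, and $\alpha_n^R,\alpha_n^L$ its right and left Verblunsky coefficients. **Theorem (Bernstein–Szegő approximation).** Let $n\ge 0$. The operator $\varphi^R_n(z)$ is invertible for every $z\in\mathbb T$, and $$d\mu^{(n)}=[\varphi^R_n(e^{i\theta})\varphi^R_n(e^{i\theta})^\dagger]^{-1}\,\frac{d\theta}{2\pi}$$ defines a nontrivial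 positive operator-valued measure (with integrable density) such that: 1. $\mu^{(n)}(\mathbb T)=\mu(\mathbb T)$; in particular $\mu^{(n)}$ is normalized, $\mu^{(n)}(\mathbb T)=I$, if $\mu$ is. 2. The right orthogonal polynomials of $\mu^{(n)}$ are $\varphi^R_j(z;\mu^{(n)})=\varphi^R_j(z;\mu)$ for $0\le j\le n$ and $\varphi^R_j(z;\mu^{(n)})=z^{j-n}\varphi^R_n(z;\mu)$ for $j>n$, and they are orthonormal: $\int\varphi^R_j(\cdot;\mu^{(n)})^\dagger\,d\mu^{(n)}\,\varphi^R_k(\cdot;\mu^{(n)})=\delta_{jk}I$ for all $j,k\ge 0$. 3. The Verblunsky coefficients of $\mu^{(n)}$, right and left, are those of $\mu$ for $0\le j\le n-1$, and $0$ for $j\ge n$: $\alpha^{R,L}_j(\mu^{(n)})=\alpha^{R,L}_j(\mu)$ for $j<n$ and $\alpha^{R,L}_j(\mu^{(n)})=0$ for $j\ge n$. -/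

import Mathlib

open MeasureTheory Filter Topology Polynomial

set_option linter.unusedSectionVars false

noncomputable section

namespace OperatorOPUC

instance instMeasurableSpaceCircle : MeasurableSpace Circle := borel Circle

instance instBorelSpaceCircle : BorelSpace Circle := ⟨rfl⟩

/-- Normalized Lebesgue measure `dθ / 2π` on the unit circle. -/
def circleMeasure : Measure Circle :=
  ENNReal.ofReal (2 * Real.pi)⁻¹ •
    (volume.restrict (Set.Ioc (-Real.pi) Real.pi)).map (fun θ : ℝ => Circle.exp θ)

variable {H : Type*} [NormedAddCommGroup H] [InnerProductSpace ℂ H] [CompleteSpace H]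

variable (H) in
/-- A positive operator-valued (semi-spectral) measure on the unit circle: a map from Borel sets
to bounded operators such that `σ ↦ ⟪μ(σ) h, h⟫` is a (finite) positive Borel measure for each `h`.
The value on a set that is not Borel is `0` by convention. -/
structure OpMeasure where
  toFun : Set Circle → (H →L[ℂ] H)
  toFun_of_not_measurable : ∀ σ, ¬ MeasurableSet σ → toFun σ = 0
  exists_scalar : ∀ h : H, ∃ m : Measure Circle, IsFiniteMeasure m ∧
    ∀ σ, MeasurableSet σ → inner ℂ (toFun σ h) h = (m.real σ : ℂ)

namespace OpMeasure

instance : CoeFun (OpMeasure H) (fun _ => Set Circle → (H →L[ℂ] H)) := ⟨OpMeasure.toFun⟩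

/-- The scalar measure `μ_h(σ) = ⟪μ(σ) h, h⟫`. -/
def scalar (μ : OpMeasure H) (h : H) : Measure Circle := Classical.choose (μ.exists_scalar h)

instance (μ : OpMeasure H) (h : H) : IsFiniteMeasure (μ.scalar h) :=
  (Classical.choose_spec (μ.exists_scalar h)).1

theorem inner_apply (μ : OpMeasure H) (h : H) {σ : Set Circle} (hσ : MeasurableSet σ) :
    inner ℂ (μ σ h) h = ((μ.scalar h).real σ : ℂ) :=
  (Classical.choose_spec (μ.exists_scalar h)).2 σ hσ

theorem exists_integral (μ : OpMeasure H) (f : C(Circle, ℂ)) :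
    ∃ A : H →L[ℂ] H, ∀ h : H, inner ℂ h (A h) = ∫ z, f z ∂(μ.scalar h) := by
  classical
  obtain ⟨s, hs⟩ : ∃ s : ℕ → SimpleFunc Circle ℂ, ∀ h : H,
      Tendsto (fun n => (s n).integral (μ.scalar h)) atTop (𝓝 (∫ z, f z ∂(μ.scalar h))) := by
    refine ⟨fun n => SimpleFunc.approxOn f f.continuous.measurable Set.univ 0 trivial n,
      fun h => ?_⟩
    refine tendsto_integral_approxOn_of_measurable_of_range_subset f.continuous.measurable ?_
      Set.univ (Set.subset_univ _)
    exact Integrable.of_bound f.continuous.aestronglyMeasurable ‖f‖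
      (Eventually.of_forall fun z => f.norm_coe_le_norm z)
  let L : ℕ → (H →L[ℂ] H) := fun n => ∑ c ∈ (s n).range, c • μ ((s n) ⁻¹' {c})
  have hL : ∀ n h, inner ℂ (L n h) h = starRingEnd ℂ ((s n).integral (μ.scalar h)) := by
    intro n h
    simp only [L, SimpleFunc.integral_eq, _root_.sum_apply, sum_inner,
      _root_.smul_apply, inner_smul_left, map_sum]
    refine Finset.sum_congr rfl fun c _ => ?_
    rw [μ.inner_apply h ((s n).measurableSet_fiber c)]
    simp [mul_comm]
  have hF : ∀ h, Tendsto (fun n => inner ℂ (L n h) h) atTop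
      (𝓝 (starRingEnd ℂ (∫ z, f z ∂(μ.scalar h)))) := by
    intro h
    simp only [hL]
    exact (Complex.continuous_conj.tendsto _).comp (hs h)
  have hB : ∀ h, ‖starRingEnd ℂ (∫ z, f z ∂(μ.scalar h))‖ ≤ ‖f‖ * ‖μ Set.univ‖ * ‖h‖ ^ 2 := by
    intro h
    rw [RCLike.norm_conj]
    refine (norm_integral_le_of_norm_le_const
      (Eventually.of_forall fun z => f.norm_coe_le_norm z)).trans ?_
    have h1 : (μ.scalar h).real Set.univ ≤ ‖μ Set.univ‖ * ‖h‖ ^ 2 := by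
      have h2 := μ.inner_apply h MeasurableSet.univ
      have h3 : ‖inner ℂ (μ Set.univ h) h‖ ≤ ‖μ Set.univ‖ * ‖h‖ * ‖h‖ :=
        (norm_inner_le_norm _ _).trans (by gcongr; exact ContinuousLinearMap.le_opNorm _ _)
      rw [h2, Complex.norm_real, Real.norm_of_nonneg measureReal_nonneg] at h3
      linarith [h3]
    rw [mul_assoc]
    gcongr
  set F : H → ℂ := fun h => starRingEnd ℂ (∫ z, f z ∂(μ.scalar h)) with hFdef
  let G : H → H → ℂ := fun x y =>
    (F (x + y) - F (x - y) - Complex.I * F (x + Complex.I • y) +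
      Complex.I * F (x - Complex.I • y)) / 4
  have hG : ∀ x y, Tendsto (fun n => inner ℂ (L n x) y) atTop (𝓝 (G x y)) := by
    intro x y
    have := fun n => inner_map_polarization' (L n : H →ₗ[ℂ] H) x y
    simp only [ContinuousLinearMap.coe_coe] at this
    simp only [this]
    exact ((((hF _).sub (hF _)).sub ((hF _).const_mul _)).add ((hF _).const_mul _)).div_const _
  have hGG : ∀ h, G h h = F h := fun h => tendsto_nhds_unique (hG h h) (hF h)
  have hadd1 : ∀ x x' y, G (x + x') y = G x y + G x' y := fun x x' y =>
    tendsto_nhds_unique (hG _ _) (by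
      simpa only [map_add, inner_add_left] using (hG x y).add (hG x' y))
  have hsm1 : ∀ (c : ℂ) x y, G (c • x) y = starRingEnd ℂ c * G x y := fun c x y =>
    tendsto_nhds_unique (hG _ _) (by
      simpa only [map_smul, inner_smul_left] using (hG x y).const_mul (starRingEnd ℂ c))
  have hadd2 : ∀ x y y', G x (y + y') = G x y + G x y' := fun x y y' =>
    tendsto_nhds_unique (hG _ _) (by
      simpa only [inner_add_right] using (hG x y).add (hG x y'))
  have hsm2 : ∀ (c : ℂ) x y, G x (c • y) = c * G x y := fun c x y =>
    tendsto_nhds_unique (hG _ _) (by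
      simpa only [inner_smul_right] using (hG x y).const_mul c)
  set K : ℝ := ‖f‖ * ‖μ Set.univ‖ with hK
  have hK0 : 0 ≤ K := by positivity
  have hunit : ∀ u v : H, ‖u‖ = 1 → ‖v‖ = 1 → ‖G u v‖ ≤ 4 * K := by
    intro u v hu hv
    have hFb : ∀ w : H, ‖w‖ ≤ 2 → ‖F w‖ ≤ 4 * K := fun w hw => by
      have := hB w
      have h4 : ‖w‖ ^ 2 ≤ 4 := by nlinarith [norm_nonneg w]
      calc ‖F w‖ ≤ K * ‖w‖ ^ 2 := this
        _ ≤ K * 4 := by gcongr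
        _ = 4 * K := by ring
    have hIv : ‖Complex.I • v‖ = 1 := by simp [norm_smul, hv]
    have e1 := hFb (u + v) ((norm_add_le _ _).trans (by linarith))
    have e2 := hFb (u - v) ((norm_sub_le _ _).trans (by linarith))
    have e3 := hFb (u + Complex.I • v) ((norm_add_le _ _).trans (by linarith))
    have e4 := hFb (u - Complex.I • v) ((norm_sub_le _ _).trans (by linarith))
    have e5 : ‖F (u + v) - F (u - v) - Complex.I * F (u + Complex.I • v) +
        Complex.I * F (u - Complex.I • v)‖ ≤ 16 * K := by
      refine (norm_add_le _ _).trans ?_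
      have a1 := norm_sub_le (F (u + v) - F (u - v)) (Complex.I * F (u + Complex.I • v))
      have a2 := norm_sub_le (F (u + v)) (F (u - v))
      rw [norm_mul, Complex.norm_I, one_mul] at *
      linarith
    simp only [G, norm_div, Complex.norm_ofNat]
    linarith
  have hbound : ∀ x y, ‖G x y‖ ≤ (4 * K) * ‖x‖ * ‖y‖ := by
    intro x y
    by_cases hx : x = 0
    · have : G x y = 0 := by simpa [hx] using hsm1 0 0 y
      rw [this, norm_zero]; positivity
    by_cases hy : y = 0
    · have : G x y = 0 := by simpa [hy] using hsm2 0 x 0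
      rw [this, norm_zero]; positivity
    have hx' : ‖x‖ ≠ 0 := norm_ne_zero_iff.2 hx
    have hy' : ‖y‖ ≠ 0 := norm_ne_zero_iff.2 hy
    have key := hunit (((‖x‖⁻¹ : ℝ) : ℂ) • x) (((‖y‖⁻¹ : ℝ) : ℂ) • y)
      (by rw [norm_smul]; simp [hx']) (by rw [norm_smul]; simp [hy'])
    rw [hsm1, hsm2, norm_mul, norm_mul, RCLike.norm_conj, Complex.norm_real, Complex.norm_real,
      norm_inv, norm_inv, norm_norm, norm_norm] at key
    have hxp : 0 < ‖x‖ := norm_pos_iff.2 hx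
    have hyp : 0 < ‖y‖ := norm_pos_iff.2 hy
    calc ‖G x y‖ = (‖x‖⁻¹ * (‖y‖⁻¹ * ‖G x y‖)) * (‖x‖ * ‖y‖) := by field_simp
      _ ≤ (4 * K) * (‖x‖ * ‖y‖) := by gcongr
      _ = (4 * K) * ‖x‖ * ‖y‖ := by ring
  let B : H →L⋆[ℂ] H →L[ℂ] ℂ :=
    (LinearMap.mk₂'ₛₗ (starRingEnd ℂ) (RingHom.id ℂ) G hadd1 hsm1 hadd2 hsm2).mkContinuous₂
      (4 * K) hbound
  refine ⟨InnerProductSpace.continuousLinearMapOfBilin B, fun h => ?_⟩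
  rw [← inner_conj_symm, InnerProductSpace.continuousLinearMapOfBilin_apply]
  change starRingEnd ℂ (G h h) = _
  rw [hGG, hFdef]
  exact Complex.conj_conj _

/-- The operator `∫ f dμ`, characterized by `⟪(∫ f dμ) h, h⟫ = ∫ f dμ_h`
(the pairing being linear in `(∫ f dμ) h`). -/
def integral (μ : OpMeasure H) (f : C(Circle, ℂ)) : H →L[ℂ] H :=
  Classical.choose (μ.exists_integral f)

theorem inner_integral (μ : OpMeasure H) (f : C(Circle, ℂ)) (h : H) :
    inner ℂ h (μ.integral f h) = ∫ z, f z ∂(μ.scalar h) :=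
  Classical.choose_spec (μ.exists_integral f) h

/-- The moments `μ_j = ∫ e^{-ijθ} dμ(θ)`. -/
def moment (μ : OpMeasure H) (j : ℤ) : H →L[ℂ] H :=
  μ.integral ⟨fun z => ((z ^ (-j) : Circle) : ℂ),
    (by fun_prop : Continuous (fun z : Circle => (z : ℂ))).comp (continuous_zpow (-j))⟩

/-- Nontriviality: on vector polynomials `f(z) = ∑_{j < N} z^j v_j`, the form
`∫ ⟪dμ f, f⟫ = ∑_{i,j} ⟪μ_{i-j} v_j, v_i⟫` is bounded below by a positive multiple of
`∑_j ‖v_j‖²`. -/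
def IsNontrivial (μ : OpMeasure H) : Prop :=
  ∀ N : ℕ, ∃ c : ℝ, 0 < c ∧ ∀ v : Fin N → H,
    c * ∑ j, ‖v j‖ ^ 2 ≤
      (∑ i : Fin N, ∑ j : Fin N, inner ℂ (v i) (μ.moment ((i : ℤ) - (j : ℤ)) (v j))).re

/-- The measure is normalized: `μ(𝕋) = I`. -/
def IsNormalized (μ : OpMeasure H) : Prop := μ Set.univ = 1

/-- `μ` has density `w` with respect to `dθ / 2π`: `μ(σ) = ∫_σ w dθ / 2π` for Borel `σ`. -/
def HasDensity (μ : OpMeasure H) (w : Circle → (H →L[ℂ] H)) : Prop :=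
  Integrable w circleMeasure ∧ ∀ σ, MeasurableSet σ → μ σ = ∫ z in σ, w z ∂circleMeasure

/-! Block Toeplitz matrices are matrices over the ring of bounded operators on `H`; their inverses
are taken in the ring of such matrices. -/

/-- The right Toeplitz operator matrix `T_n^R = (μ_{i-j})_{0 ≤ i,j < n}`. -/
def toeplitzR (μ : OpMeasure H) (n : ℕ) : Matrix (Fin n) (Fin n) (H →L[ℂ] H) :=
  Matrix.of fun i j => μ.moment ((i : ℤ) - (j : ℤ))

/-- The left Toeplitz operator matrix `T_n^L = (μ_{j-i})_{0 ≤ i,j < n}`. -/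
def toeplitzL (μ : OpMeasure H) (n : ℕ) : Matrix (Fin n) (Fin n) (H →L[ℂ] H) :=
  Matrix.of fun i j => μ.moment ((j : ℤ) - (i : ℤ))

/-- The column `ν_n = (μ_{-n}, …, μ_{-1})`. -/
def nuCol (μ : OpMeasure H) (n : ℕ) (i : Fin n) : H →L[ℂ] H := μ.moment ((i : ℤ) - (n : ℤ))

/-- The column `ξ_n = (μ_n, …, μ_1)`. -/
def xiCol (μ : OpMeasure H) (n : ℕ) (i : Fin n) : H →L[ℂ] H := μ.moment ((n : ℤ) - (i : ℤ))

/-- The Schur complement `κ_n^R = μ_0 - ν_n† (T_n^R)⁻¹ ν_n`. -/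
def kappaR (μ : OpMeasure H) (n : ℕ) : H →L[ℂ] H :=
  μ.moment 0 - ∑ i, ∑ j, star (μ.nuCol n i) * Ring.inverse (μ.toeplitzR n) i j * μ.nuCol n j

/-- The Schur complement `κ_n^L = μ_0 - ξ_n† (T_n^L)⁻¹ ξ_n`. -/
def kappaL (μ : OpMeasure H) (n : ℕ) : H →L[ℂ] H :=
  μ.moment 0 - ∑ i, ∑ j, star (μ.xiCol n i) * Ring.inverse (μ.toeplitzL n) i j * μ.xiCol n j

/-- The monic right orthogonal polynomial
`Φ_n^R(z) = z^n - [I, z, …, z^{n-1}] (T_n^R)⁻¹ ν_n`. -/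
def monicR (μ : OpMeasure H) (n : ℕ) : (H →L[ℂ] H)[X] :=
  X ^ n - ∑ i : Fin n, ∑ j : Fin n,
    C (Ring.inverse (μ.toeplitzR n) i j * μ.nuCol n j) * X ^ (i : ℕ)

/-- The monic left orthogonal polynomial
`Φ_n^L(z) = z^n - [μ_{-n}, …, μ_{-1}] (T_n^L)⁻¹ [I, z, …, z^{n-1}]ᵀ`. -/
def monicL (μ : OpMeasure H) (n : ℕ) : (H →L[ℂ] H)[X] :=
  X ^ n - ∑ i : Fin n, ∑ j : Fin n,
    C (μ.nuCol n i * Ring.inverse (μ.toeplitzL n) i j) * X ^ (j : ℕ)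

/-- The normalized right orthogonal polynomial `φ_n^R = Φ_n^R (κ_n^R)^{-1/2}`. -/
def phiR (μ : OpMeasure H) (n : ℕ) : (H →L[ℂ] H)[X] :=
  μ.monicR n * C (Ring.inverse (CFC.sqrt (μ.kappaR n)))

/-- The right Verblunsky coefficient
`α_n^R = -((κ_n^R)^{-1/2})† Φ_{n+1}^R(0)† (κ_n^L)^{1/2}`. -/
def verblunskyR (μ : OpMeasure H) (n : ℕ) : H →L[ℂ] H :=
  -(star (Ring.inverse (CFC.sqrt (μ.kappaR n))) * star ((μ.monicR (n + 1)).eval 0) *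
    CFC.sqrt (μ.kappaL n))

/-- The left Verblunsky coefficient
`α_n^L = -(κ_n^R)^{1/2} Φ_{n+1}^L(0)† ((κ_n^L)^{-1/2})†`. -/
def verblunskyL (μ : OpMeasure H) (n : ℕ) : H →L[ℂ] H :=
  -(CFC.sqrt (μ.kappaR n) * star ((μ.monicL (n + 1)).eval 0) *
    star (Ring.inverse (CFC.sqrt (μ.kappaL n))))

end OpMeasure

/-- The value `P(z)` of an operator polynomial at a point of the unit circle. -/
def evalAt (P : (H →L[ℂ] H)[X]) (z : Circle) : H →L[ℂ] H :=
  P.eval (algebraMap ℂ (H →L[ℂ] H) (z : ℂ))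

/-- The Bernstein–Szegő density `[φ_n^R(z) φ_n^R(z)†]⁻¹`. -/
def bernsteinSzegoDensity (μ : OpMeasure H) (n : ℕ) (z : Circle) : H →L[ℂ] H :=
  Ring.inverse (evalAt (μ.phiR n) z * star (evalAt (μ.phiR n) z))

end OperatorOPUC

end

noncomputable section

namespace OperatorOPUC

variable {H : Type*} [NormedAddCommGroup H] [InnerProductSpace ℂ H] [CompleteSpace H]

theorem ext_inner_self {A B : H →L[ℂ] H} (h : ∀ x, inner ℂ x (A x) = inner ℂ x (B x)) : A = B := by
  have := (ext_inner_map (A : H →ₗ[ℂ] H) (B : H →ₗ[ℂ] H)).1 fun x => by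
    rw [← inner_conj_symm, ← inner_conj_symm (_ : H) x]
    exact congrArg _ (h x)
  ext x
  exact LinearMap.congr_fun this x

/-- The operator on `H^N` given by a matrix of operators. -/
def blockOp {N : ℕ} (T : Matrix (Fin N) (Fin N) (H →L[ℂ] H)) :
    PiLp 2 (fun _ : Fin N => H) →L[ℂ] PiLp 2 (fun _ : Fin N => H) :=
  ((PiLp.continuousLinearEquiv 2 ℂ (fun _ : Fin N => H)).symm :
      (Fin N → H) →L[ℂ] PiLp 2 (fun _ : Fin N => H)) ∘L
    ContinuousLinearMap.pi fun i => ∑ j, T i j ∘L PiLp.proj 2 (fun _ : Fin N => H) j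

theorem blockOp_apply {N : ℕ} (T : Matrix (Fin N) (Fin N) (H →L[ℂ] H))
    (x : PiLp 2 (fun _ : Fin N => H)) (i : Fin N) : blockOp T x i = ∑ j, T i j (x j) := by
  simp [blockOp]

/-- A matrix of operators that is bounded below as a quadratic form is invertible. -/
theorem isUnit_matrix_of_coercive {N : ℕ} (T : Matrix (Fin N) (Fin N) (H →L[ℂ] H)) {c : ℝ}
    (hc : 0 < c) (h : ∀ v : Fin N → H,
      c * ∑ j, ‖v j‖ ^ 2 ≤ (∑ i, ∑ j, inner ℂ (v i) (T i j (v j))).re) : IsUnit T := by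
  have hU : IsUnit (blockOp T) := by
    refine ContinuousLinearMap.isUnit_of_forall_le_norm_inner_map _ (c := ⟨c, hc.le⟩) hc
      fun x => ?_
    have h1 := h x
    rw [← PiLp.norm_sq_eq_of_L2] at h1
    have h2 : inner ℂ x (blockOp T x) = ∑ i, ∑ j, inner ℂ (x i) (T i j (x j)) := by
      simp [PiLp.inner_apply, blockOp_apply, inner_sum]
    rw [norm_inner_symm, h2]
    refine le_trans ?_ (Complex.re_le_norm _)
    rw [mul_comm]
    exact h1
  obtain ⟨S, hTS, hST⟩ := isUnit_iff_exists.1 hU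
  let e : Fin N → H →L[ℂ] PiLp 2 (fun _ : Fin N => H) := fun j =>
    ((PiLp.continuousLinearEquiv 2 ℂ (fun _ : Fin N => H)).symm :
      (Fin N → H) →L[ℂ] PiLp 2 (fun _ : Fin N => H)) ∘L ContinuousLinearMap.single ℂ (fun _ : Fin N => H) j
  have he : ∀ i j x, e j x i = if i = j then x else 0 := by
    intro i j x
    simp [e]
  have hsum : ∀ x : PiLp 2 (fun _ : Fin N => H), ∑ k, e k (x k) = x := by
    intro x
    ext i
    simp [he]
  let G : Matrix (Fin N) (Fin N) (H →L[ℂ] H) :=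
    Matrix.of fun i j => PiLp.proj 2 (fun _ : Fin N => H) i ∘L S ∘L e j
  have hG : ∀ i j x, G i j x = S (e j x) i := fun i j x => rfl
  have hone : ∀ (i j : Fin N) (x : H),
      (1 : Matrix (Fin N) (Fin N) (H →L[ℂ] H)) i j x = if i = j then x else 0 := by
    intro i j x
    rw [Matrix.one_apply]
    split_ifs <;> simp
  refine isUnit_iff_exists.2 ⟨G, ?_, ?_⟩
  · ext i j x
    rw [hone, Matrix.mul_apply, _root_.sum_apply]
    have := congrArg (fun B => B (e j x) i) hTS
    simp only [_root_.mul_apply_eq_comp, blockOp_apply, _root_.one_apply_eq_self, he] at this ⊢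
    exact this
  · ext i j x
    rw [hone, Matrix.mul_apply, _root_.sum_apply]
    have := congrArg (fun B => B (e j x) i) hST
    simp only [_root_.mul_apply_eq_comp, _root_.one_apply_eq_self, he, hG] at this ⊢
    rw [← hsum (blockOp T (e j x)), map_sum, WithLp.ofLp_sum,
      Finset.sum_apply] at this
    simpa [blockOp_apply, he, apply_ite (T _ _)] using this

namespace OpMeasure

theorem moment_zero (μ : OpMeasure H) : μ.moment 0 = μ Set.univ := by
  refine ext_inner_self fun x => ?_
  rw [moment, inner_integral, ← inner_conj_symm, μ.inner_apply x MeasurableSet.univ]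
  simp

theorem inner_moment (μ : OpMeasure H) (k : ℤ) (x : H) :
    inner ℂ x (μ.moment k x) = ∫ z, ((z : ℂ)) ^ (-k) ∂(μ.scalar x) := by
  rw [moment, inner_integral]
  simp

theorem star_moment (μ : OpMeasure H) (k : ℤ) : star (μ.moment k) = μ.moment (-k) := by
  refine ext_inner_self fun x => ?_
  rw [ContinuousLinearMap.star_eq_adjoint, ContinuousLinearMap.adjoint_inner_right,
    ← inner_conj_symm, inner_moment, inner_moment, ← integral_conj]
  refine integral_congr_ae (Eventually.of_forall fun z => ?_)
  change (starRingEnd ℂ) ((z : ℂ) ^ (-k)) = (z : ℂ) ^ (- -k)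
  rw [map_zpow₀, ← Circle.coe_inv_eq_conj, Circle.coe_inv, inv_zpow, neg_neg, zpow_neg, inv_inv]

theorem isUnit_toeplitzR (μ : OpMeasure H) (hμ : μ.IsNontrivial) (n : ℕ) :
    IsUnit (μ.toeplitzR n) := by
  obtain ⟨c, hc, h⟩ := hμ n
  exact isUnit_matrix_of_coercive _ hc h

theorem isUnit_toeplitzL (μ : OpMeasure H) (hμ : μ.IsNontrivial) (n : ℕ) :
    IsUnit (μ.toeplitzL n) := by
  obtain ⟨c, hc, h⟩ := hμ n
  refine isUnit_matrix_of_coercive _ hc fun v => ?_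
  have := h fun i => v (Fin.rev i)
  have h2 : ∑ i, ‖v (Fin.rev i)‖ ^ 2 = ∑ i, ‖v i‖ ^ 2 :=
    Equiv.sum_comp Fin.revPerm (fun i => ‖v i‖ ^ 2)
  rw [h2] at this
  refine this.trans_eq (congrArg _ ?_)
  rw [← Equiv.sum_comp Fin.revPerm]
  refine Finset.sum_congr rfl fun i _ => ?_
  rw [← Equiv.sum_comp Fin.revPerm]
  refine Finset.sum_congr rfl fun j _ => ?_
  simp only [Fin.revPerm_apply, toeplitzL, Matrix.of_apply, Fin.rev_rev, Fin.val_rev]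
  congr 3
  omega

end OpMeasure

/-- `P` is the monic polynomial of degree `n` that is right orthogonal to all lower powers with
respect to the moments `M`, and `κ` is its squared norm. -/
structure IsMonicOrthR (M : ℤ → H →L[ℂ] H) (n : ℕ) (P : (H →L[ℂ] H)[X]) (κ : H →L[ℂ] H) :
    Prop where
  coeff_self : P.coeff n = 1
  coeff_of_lt : ∀ i, n < i → P.coeff i = 0
  sum_eq : ∀ i : ℤ, 0 ≤ i → i ≤ n →
    ∑ j ∈ Finset.range (n + 1), M (i - j) * P.coeff j = if i = n then κ else 0

/-- The left analogue of `IsMonicOrthR`. -/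
structure IsMonicOrthL (M : ℤ → H →L[ℂ] H) (n : ℕ) (P : (H →L[ℂ] H)[X]) (κ : H →L[ℂ] H) :
    Prop where
  coeff_self : P.coeff n = 1
  sum_eq : ∀ i : ℤ, 0 ≤ i → i ≤ n →
    ∑ j ∈ Finset.range (n + 1), P.coeff j * M (i - j) = if i = n then κ else 0

theorem IsMonicOrthR.sum_reflect {M : ℤ → H →L[ℂ] H} {n : ℕ} {P : (H →L[ℂ] H)[X]}
    {κ : H →L[ℂ] H} (hP : IsMonicOrthR M n P κ) {N m : ℕ} (hm : m ≤ n)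
    (d : ℕ → H →L[ℂ] H) (hN : N ≤ m) :
    ∑ j ∈ Finset.range (N + 1), d j *
      ∑ i ∈ Finset.range (n + 1), M ((m : ℤ) - j - i) * P.coeff i = if m = n then d 0 * κ else 0 := by
  rw [Finset.sum_range_succ', Finset.sum_eq_zero, zero_add]
  · rw [hP.sum_eq _ (by simp) (by simpa using hm)]
    simp
  · intro j hj
    have := Finset.mem_range.1 hj
    rw [hP.sum_eq _ (by omega) (by omega), if_neg (by omega), mul_zero]

theorem IsMonicOrthL.sum_reflect {M : ℤ → H →L[ℂ] H} {n : ℕ} {P : (H →L[ℂ] H)[X]}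
    {κ : H →L[ℂ] H} (hP : IsMonicOrthL M n P κ) {N m : ℕ} (hm : m ≤ n)
    (d : ℕ → H →L[ℂ] H) (hN : N ≤ m) :
    ∑ i ∈ Finset.range (N + 1),
      (∑ j ∈ Finset.range (n + 1), P.coeff j * M ((m : ℤ) - j - i)) * d i =
        if m = n then κ * d 0 else 0 := by
  have hc : ∀ i j : ℕ, (m : ℤ) - j - i = m - i - j := fun i j => by ring
  simp only [hc]
  rw [Finset.sum_range_succ', Finset.sum_eq_zero, zero_add]
  · rw [hP.sum_eq _ (by simp) (by simpa using hm)]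
    simp
  · intro j hj
    have := Finset.mem_range.1 hj
    rw [hP.sum_eq _ (by omega) (by omega), if_neg (by omega), zero_mul]

theorem sum_mul_sum_comm (a b : ℕ → H →L[ℂ] H) (M : ℕ → ℕ → H →L[ℂ] H) (s t : Finset ℕ) :
    ∑ j ∈ s, a j * ∑ i ∈ t, M j i * b i = ∑ i ∈ t, (∑ j ∈ s, a j * M j i) * b i := by
  simp only [Finset.mul_sum, Finset.sum_mul, mul_assoc]
  exact Finset.sum_comm

/-- The constant terms of consecutive left and right orthogonal polynomials are related by
`κ_n^L Φ_{n+1}^R(0) = Φ_{n+1}^L(0) κ_n^R`. -/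
theorem kappaL_mul_coeff_zero {M : ℤ → H →L[ℂ] H} {n : ℕ} {P P' Q Q' : (H →L[ℂ] H)[X]}
    {κ κ' l l' : H →L[ℂ] H} (hP : IsMonicOrthR M n P κ) (hP' : IsMonicOrthR M (n + 1) P' κ')
    (hQ : IsMonicOrthL M n Q l) (hQ' : IsMonicOrthL M (n + 1) Q' l') :
    l * P'.coeff 0 = Q'.coeff 0 * κ := by
  have e1 := hP'.sum_reflect (N := n) (Nat.le_succ n) Q.coeff le_rfl
  rw [if_neg (by omega), sum_mul_sum_comm, Finset.sum_range_succ,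
    hQ.sum_reflect le_rfl P'.coeff le_rfl, if_pos rfl, hP'.coeff_self, mul_one] at e1
  have e2 := hQ'.sum_reflect (N := n) (Nat.le_succ n) P.coeff le_rfl
  rw [if_neg (by omega), ← sum_mul_sum_comm, Finset.sum_range_succ,
    hP.sum_reflect le_rfl Q'.coeff le_rfl, if_pos rfl, hQ'.coeff_self, one_mul] at e2
  have e3 : ∑ i ∈ Finset.range (n + 1), M ((n : ℤ) - (n + 1 : ℕ) - i) * P.coeff i =
      ∑ j ∈ Finset.range (n + 1), Q.coeff j * M ((n : ℤ) - j - (n + 1 : ℕ)) := by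
    rcases n with _ | m
    · simp [hP.coeff_self, hQ.coeff_self]
    have f1 := hP.sum_reflect (N := m) (Nat.le_succ m) Q.coeff le_rfl
    have f2 := hQ.sum_reflect (N := m) (Nat.le_succ m) P.coeff le_rfl
    rw [if_neg (by omega)] at f1 f2
    have f3 := sum_mul_sum_comm Q.coeff P.coeff (fun j i => M ((m : ℤ) - j - i))
      (Finset.range (m + 1 + 1)) (Finset.range (m + 1 + 1))
    replace f3 := (Finset.sum_range_succ _ (m + 1)).symm.trans
      (f3.trans (Finset.sum_range_succ _ (m + 1)))
    rw [f1, f2, hQ.coeff_self, hP.coeff_self, one_mul, mul_one, zero_add, zero_add] at f3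
    convert f3 using 3
    · congr 1; push_cast; ring
    · congr 1; push_cast; ring
  rw [e3] at e2
  rw [eq_neg_of_add_eq_zero_left e1, eq_neg_of_add_eq_zero_left e2]

namespace OpMeasure

theorem coeff_monicR (μ : OpMeasure H) (n k : ℕ) :
    (μ.monicR n).coeff k = (if k = n then 1 else 0) -
      if h : k < n then ∑ j, Ring.inverse (μ.toeplitzR n) ⟨k, h⟩ j * μ.nuCol n j else 0 := by
  rw [monicR, coeff_sub, coeff_X_pow, finsetSum_coeff]
  congr 1
  simp only [finsetSum_coeff, coeff_C_mul, coeff_X_pow, mul_ite, mul_one, mul_zero]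
  split_ifs with h
  · rw [Finset.sum_eq_single ⟨k, h⟩]
    · simp
    · intro i _ hi
      simp [show k ≠ i from fun e => hi (Fin.ext e.symm)]
    · simp
  · refine Finset.sum_eq_zero fun i _ => ?_
    simp [show k ≠ i from fun e => h (e ▸ i.2)]

theorem coeff_monicL (μ : OpMeasure H) (n k : ℕ) :
    (μ.monicL n).coeff k = (if k = n then 1 else 0) -
      if h : k < n then ∑ i, μ.nuCol n i * Ring.inverse (μ.toeplitzL n) i ⟨k, h⟩ else 0 := by
  rw [monicL, coeff_sub, coeff_X_pow, Finset.sum_comm, finsetSum_coeff]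
  congr 1
  simp only [finsetSum_coeff, coeff_C_mul, coeff_X_pow, mul_ite, mul_one, mul_zero]
  split_ifs with h
  · rw [Finset.sum_eq_single ⟨k, h⟩]
    · simp
    · intro i _ hi
      simp [show k ≠ i from fun e => hi (Fin.ext e.symm)]
    · simp
  · refine Finset.sum_eq_zero fun i _ => ?_
    simp [show k ≠ i from fun e => h (e ▸ i.2)]

theorem isMonicOrthR_monicR (μ : OpMeasure H) (hμ : μ.IsNontrivial) (n : ℕ) :
    IsMonicOrthR μ.moment n (μ.monicR n) (μ.kappaR n) := by
  refine ⟨by simp [coeff_monicR], fun i hi => ?_, fun i hi0 hin => ?_⟩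
  · simp [coeff_monicR, hi.ne', hi.not_gt]
  have hself : (μ.monicR n).coeff n = 1 := by simp [coeff_monicR]
  lift i to ℕ using hi0
  rw [Finset.sum_range_succ, Finset.sum_range, hself, mul_one]
  have hc : ∀ j : Fin n, (μ.monicR n).coeff j =
      -∑ k, Ring.inverse (μ.toeplitzR n) j k * μ.nuCol n k := fun j => by
    simp [coeff_monicR, j.2.ne]
  simp only [hc]
  split_ifs with h
  · obtain rfl : i = n := by exact_mod_cast h
    simp only [kappaR, sub_self, mul_neg, Finset.sum_neg_distrib, Finset.mul_sum, nuCol,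
      star_moment, neg_sub, mul_assoc]
    abel
  · have hlt : i < n := by omega
    have hT := Ring.mul_inverse_cancel _ (μ.isUnit_toeplitzR hμ n)
    have h1 : ∑ k, (μ.toeplitzR n * Ring.inverse (μ.toeplitzR n)) ⟨i, hlt⟩ k * μ.nuCol n k =
        μ.moment (i - n) := by
      rw [hT, Finset.sum_eq_single ⟨i, hlt⟩]
      · simp [nuCol]
      · intro b _ hb
        simp [hb.symm]
      · simp
    rw [← h1]
    simp only [Matrix.mul_apply, Finset.sum_mul, Finset.mul_sum, mul_neg, Finset.sum_neg_distrib,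
      mul_assoc]
    rw [Finset.sum_comm, neg_add_eq_zero]
    rfl

theorem isMonicOrthL_monicL (μ : OpMeasure H) (hμ : μ.IsNontrivial) (n : ℕ) :
    IsMonicOrthL μ.moment n (μ.monicL n) (μ.kappaL n) := by
  refine ⟨by simp [coeff_monicL], fun i hi0 hin => ?_⟩
  have hself : (μ.monicL n).coeff n = 1 := by simp [coeff_monicL]
  lift i to ℕ using hi0
  rw [Finset.sum_range_succ, Finset.sum_range, hself, one_mul]
  have hc : ∀ j : Fin n, (μ.monicL n).coeff j =
      -∑ k, μ.nuCol n k * Ring.inverse (μ.toeplitzL n) k j := fun j => by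
    simp [coeff_monicL, j.2.ne]
  simp only [hc]
  split_ifs with h
  · obtain rfl : i = n := by exact_mod_cast h
    simp only [kappaL, sub_self, neg_mul, Finset.sum_neg_distrib, Finset.sum_mul, nuCol, xiCol,
      star_moment, neg_sub]
    rw [Finset.sum_comm]
    abel
  · have hlt : i < n := by omega
    have hT := Ring.inverse_mul_cancel _ (μ.isUnit_toeplitzL hμ n)
    have h1 : ∑ k, μ.nuCol n k * (Ring.inverse (μ.toeplitzL n) * μ.toeplitzL n) k ⟨i, hlt⟩ =
        μ.moment (i - n) := by
      rw [hT, Finset.sum_eq_single ⟨i, hlt⟩]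
      · simp [nuCol]
      · intro b _ hb
        simp [hb]
      · simp
    rw [← h1]
    simp only [Matrix.mul_apply, Finset.sum_mul, Finset.mul_sum, neg_mul, Finset.sum_neg_distrib,
      ← mul_assoc]
    rw [Finset.sum_comm, neg_add_eq_zero]
    rfl

theorem _root_.OperatorOPUC.IsMonicOrthR.unique {μ : OpMeasure H} (hμ : μ.IsNontrivial) {n : ℕ}
    {P Q : (H →L[ℂ] H)[X]} {κ l : H →L[ℂ] H} (hP : IsMonicOrthR μ.moment n P κ)
    (hQ : IsMonicOrthR μ.moment n Q l) : P = Q ∧ κ = l := by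
  have hz : ∀ i : Fin n, ∑ j : Fin n, μ.toeplitzR n i j * (P.coeff j - Q.coeff j) = 0 := by
    intro i
    have e1 := hP.sum_eq i (by simp) (by simp [i.2.le])
    have e2 := hQ.sum_eq i (by simp) (by simp [i.2.le])
    have hi : (i : ℤ) ≠ n := by exact_mod_cast i.2.ne
    rw [if_neg hi, Finset.sum_range_succ, Finset.sum_range, hP.coeff_self] at e1
    rw [if_neg hi, Finset.sum_range_succ, Finset.sum_range, hQ.coeff_self] at e2
    simp only [mul_sub, Finset.sum_sub_distrib, toeplitzR, Matrix.of_apply]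
    rw [eq_neg_of_add_eq_zero_left e1, eq_neg_of_add_eq_zero_left e2, sub_self]
  have hT := Ring.inverse_mul_cancel _ (μ.isUnit_toeplitzR hμ n)
  have hPQ : P = Q := by
    ext1 k
    rcases lt_trichotomy k n with h | rfl | h
    · have h1 : ∑ j, (Ring.inverse (μ.toeplitzR n) * μ.toeplitzR n) ⟨k, h⟩ j *
          (P.coeff j - Q.coeff j) = 0 := by
        simp only [Matrix.mul_apply, Finset.sum_mul, mul_assoc]
        rw [Finset.sum_comm]
        simp only [← Finset.mul_sum, hz, mul_zero, Finset.sum_const_zero]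
      rw [hT, Finset.sum_eq_single ⟨k, h⟩] at h1
      · simpa [sub_eq_zero] using h1
      · intro b _ hb
        simp [hb.symm]
      · simp
    · rw [hP.coeff_self, hQ.coeff_self]
    · rw [hP.coeff_of_lt k h, hQ.coeff_of_lt k h]
  refine ⟨hPQ, ?_⟩
  have e1 := hP.sum_eq n (by simp) le_rfl
  have e2 := hQ.sum_eq n (by simp) le_rfl
  rw [if_pos rfl] at e1 e2
  rw [← e1, ← e2, hPQ]

section Congr

variable {μ ν : OpMeasure H} {n : ℕ} (h : ∀ k : ℤ, |k| ≤ n → ν.moment k = μ.moment k)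
include h

theorem toeplitzR_congr : ν.toeplitzR n = μ.toeplitzR n := by
  ext1 i j
  exact h _ (by rw [abs_le]; omega)

theorem toeplitzL_congr : ν.toeplitzL n = μ.toeplitzL n := by
  ext1 i j
  exact h _ (by rw [abs_le]; omega)

theorem nuCol_congr : ν.nuCol n = μ.nuCol n := by
  ext1 i
  exact h _ (by rw [abs_le]; omega)

theorem xiCol_congr : ν.xiCol n = μ.xiCol n := by
  ext1 i
  exact h _ (by rw [abs_le]; omega)

theorem monicR_congr : ν.monicR n = μ.monicR n := by
  rw [monicR, monicR, toeplitzR_congr h, nuCol_congr h]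

theorem monicL_congr : ν.monicL n = μ.monicL n := by
  rw [monicL, monicL, toeplitzL_congr h, nuCol_congr h]

theorem kappaR_congr : ν.kappaR n = μ.kappaR n := by
  rw [kappaR, kappaR, toeplitzR_congr h, nuCol_congr h, h 0 (by simp)]

theorem kappaL_congr : ν.kappaL n = μ.kappaL n := by
  rw [kappaL, kappaL, toeplitzL_congr h, xiCol_congr h, h 0 (by simp)]

end Congr

end OpMeasure

/-- The Toeplitz form `∑_{i,j < N} ⟪f_i, M_{i-j} g_j⟫`. -/
def toeplitzForm (M : ℤ → H →L[ℂ] H) (N : ℕ) (f g : ℕ → H) : ℂ :=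
  ∑ i ∈ Finset.range N, ∑ j ∈ Finset.range N, inner ℂ (f i) (M ((i : ℤ) - j) (g j))

/-- Shifting a sequence to the right, which is multiplication by `z`. -/
def shiftSeq (f : ℕ → H) : ℕ → H
  | 0 => 0
  | i + 1 => f i

section Form

variable (M : ℤ → H →L[ℂ] H) (N : ℕ) (f f' g g' : ℕ → H)

theorem toeplitzForm_sub_left :
    toeplitzForm M N (f - f') g = toeplitzForm M N f g - toeplitzForm M N f' g := by
  simp [toeplitzForm, Finset.sum_sub_distrib]

theorem toeplitzForm_sub_right :
    toeplitzForm M N f (g - g') = toeplitzForm M N f g - toeplitzForm M N f g' := by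
  simp [toeplitzForm, Finset.sum_sub_distrib]

theorem toeplitzForm_smul_left (a : ℂ) :
    toeplitzForm M N (a • f) g = starRingEnd ℂ a * toeplitzForm M N f g := by
  simp [toeplitzForm, Finset.mul_sum, mul_comm]

theorem toeplitzForm_smul_right (a : ℂ) :
    toeplitzForm M N f (a • g) = a * toeplitzForm M N f g := by
  simp [toeplitzForm, Finset.mul_sum]

theorem toeplitzForm_shift :
    toeplitzForm M (N + 1) (shiftSeq f) (shiftSeq g) = toeplitzForm M N f g := by
  simp [toeplitzForm, Finset.sum_range_succ', shiftSeq]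

theorem toeplitzForm_succ_of_eq_zero (hf : f N = 0) (hg : g N = 0) :
    toeplitzForm M (N + 1) f g = toeplitzForm M N f g := by
  simp [toeplitzForm, Finset.sum_range_succ, hf, hg]

variable {M N f g f' g'} in
theorem toeplitzForm_congr (hf : ∀ i < N, f i = f' i) (hg : ∀ i < N, g i = g' i) :
    toeplitzForm M N f g = toeplitzForm M N f' g' := by
  refine Finset.sum_congr rfl fun i hi => Finset.sum_congr rfl fun j hj => ?_
  rw [hf i (Finset.mem_range.1 hi), hg j (Finset.mem_range.1 hj)]

variable {M} in
theorem conj_toeplitzForm (hM : ∀ k, star (M k) = M (-k)) :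
    starRingEnd ℂ (toeplitzForm M N f g) = toeplitzForm M N g f := by
  simp only [toeplitzForm, map_sum, inner_conj_symm]
  rw [Finset.sum_comm]
  refine Finset.sum_congr rfl fun i _ => Finset.sum_congr rfl fun j _ => ?_
  rw [← ContinuousLinearMap.adjoint_inner_right, ← ContinuousLinearMap.star_eq_adjoint, hM,
    neg_sub]

theorem toeplitzForm_single (i j : ℕ) (hi : i < N) (hj : j < N) (x y : H) :
    toeplitzForm M N (Pi.single i x) (Pi.single j y) = inner ℂ x (M ((i : ℤ) - j) y) := by
  rw [toeplitzForm, Finset.sum_eq_single i, Finset.sum_eq_single j]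
  · simp
  · intro b _ hb
    simp [hb]
  · simp [hj]
  · intro b _ hb
    simp [hb]
  · simp [hi]

end Form

theorem IsMonicOrthR.toeplitzForm_right {M : ℤ → H →L[ℂ] H} {n : ℕ} {P : (H →L[ℂ] H)[X]}
    {κ : H →L[ℂ] H} (hP : IsMonicOrthR M n P κ) (f : ℕ → H) (x : H) :
    toeplitzForm M (n + 1) f (fun i => P.coeff i x) = inner ℂ (f n) (κ x) := by
  have h : ∀ i ∈ Finset.range (n + 1), ∑ j ∈ Finset.range (n + 1),
      inner ℂ (f i) (M ((i : ℤ) - j) (P.coeff j x)) =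
        if i = n then inner ℂ (f n) (κ x) else 0 := by
    intro i hi
    have hin := Finset.mem_range.1 hi
    have := congrArg (fun A => A x) (hP.sum_eq i (by simp) (by omega))
    simp only [_root_.sum_apply, _root_.mul_apply_eq_comp] at this
    rw [← inner_sum, this]
    by_cases h : i = n <;> simp [h]
  rw [toeplitzForm, Finset.sum_congr rfl h]
  simp

namespace OpMeasure

variable {μ : OpMeasure H} (hμ : μ.IsNontrivial)
include hμ

theorem IsNontrivial.le_toeplitzForm (N : ℕ) : ∃ c : ℝ, 0 < c ∧ ∀ f : ℕ → H,
    c * ∑ j ∈ Finset.range N, ‖f j‖ ^ 2 ≤ (toeplitzForm μ.moment N f f).re := by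
  obtain ⟨c, hc, h⟩ := hμ N
  refine ⟨c, hc, fun f => ?_⟩
  simpa only [toeplitzForm, Finset.sum_range] using h fun j => f j

theorem IsNontrivial.toeplitzForm_nonneg (N : ℕ) (f : ℕ → H) :
    0 ≤ (toeplitzForm μ.moment N f f).re := by
  obtain ⟨c, hc, h⟩ := hμ.le_toeplitzForm N
  exact le_trans (by positivity) (h f)

theorem IsNontrivial.le_inner_kappa {n : ℕ} {P : (H →L[ℂ] H)[X]} {κ : H →L[ℂ] H}
    (hP : IsMonicOrthR μ.moment n P κ) :
    ∃ c : ℝ, 0 < c ∧ ∀ x, c * ‖x‖ ^ 2 ≤ (inner ℂ x (κ x)).re := by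
  obtain ⟨c, hc, h⟩ := hμ.le_toeplitzForm (n + 1)
  refine ⟨c, hc, fun x => ?_⟩
  have h1 := h fun i => P.coeff i x
  rw [hP.toeplitzForm_right, hP.coeff_self, Finset.sum_range_succ, hP.coeff_self] at h1
  simp only [_root_.one_apply_eq_self] at h1
  refine le_trans ?_ h1
  gcongr
  simp only [le_add_iff_nonneg_left]
  positivity

/-- The reversed orthogonal polynomial is bounded below on the closed unit disc. -/
theorem IsNontrivial.le_norm_reverse {n : ℕ} {P : (H →L[ℂ] H)[X]} {κ : H →L[ℂ] H}
    (hP : IsMonicOrthR μ.moment n P κ) {w : ℂ} (hw : ‖w‖ ≤ 1) :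
    ∃ c : ℝ, 0 < c ∧ ∀ x, c * ‖x‖ ≤
      ‖(∑ j ∈ Finset.range (n + 1), w ^ (n - j) • P.coeff j) x‖ := by
  obtain ⟨c, hc, hκ⟩ := hμ.le_inner_kappa hP
  let R : ℕ → H →L[ℂ] H := fun i => ∑ j ∈ Finset.range (i + 1), w ^ (i - j) • P.coeff j
  have hR : ∀ i, R (i + 1) = P.coeff (i + 1) + w • R i := by
    intro i
    simp only [R]
    rw [Finset.sum_range_succ, Finset.smul_sum, add_comm]
    congr 1
    · simp
    · refine Finset.sum_congr rfl fun j hj => ?_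
      rw [smul_smul, ← pow_succ', Nat.sub_add_comm (Finset.mem_range_succ_iff.1 hj)]
  have hR0 : R 0 = P.coeff 0 := by simp [R]
  let Z : H →L[ℂ] H := (2 * w) • ∑ i ∈ Finset.range (n + 1),
    if i = 0 then 0 else μ.moment ((n : ℤ) - i) * R (i - 1)
  have key : ∀ x, c * ‖x‖ ^ 2 ≤ ‖R n x‖ * (‖μ.moment 0 * R n - Z‖ * ‖x‖) := by
    intro x
    let v : ℕ → H := fun i => P.coeff i x
    let a : ℕ → H := fun i => if i < n then R i x else 0
    let p : ℕ → H := Pi.single n (R n x)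
    let s : ℕ → H := shiftSeq fun i => R i x
    have hv : ∀ i < n + 1, v i = (a + p - w • s) i := by
      intro i hi
      rcases i with _ | i
      · by_cases hn : 0 < n
        · simp [v, a, p, s, shiftSeq, hn, hn.ne, hR0]
        · obtain rfl : n = 0 := by omega
          simp [v, a, p, s, shiftSeq, hR0]
      · by_cases hn : i + 1 < n
        · simp [v, a, p, s, shiftSeq, hn, hn.ne, hR]
        · obtain rfl : i + 1 = n := by omega
          simp [v, a, p, s, shiftSeq, hR]
    have hva : ∀ i < n + 1, (v - a) i = (p - w • s) i := by
      intro i hi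
      rw [Pi.sub_apply, hv i hi]
      simp only [Pi.add_apply, Pi.sub_apply]
      abel
    have hM := μ.star_moment
    have e1 := toeplitzForm_congr (M := μ.moment) hva hva
    have an : a n = 0 := by simp [a]
    have hav : toeplitzForm μ.moment (n + 1) a v = 0 := by
      rw [hP.toeplitzForm_right, an, inner_zero_left]
    have hvv : toeplitzForm μ.moment (n + 1) v v = inner ℂ x (κ x) := by
      rw [hP.toeplitzForm_right]
      simp [v, hP.coeff_self]
    have haa : toeplitzForm μ.moment (n + 1) a a =
        toeplitzForm μ.moment n (fun i => R i x) (fun i => R i x) := by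
      rw [toeplitzForm_succ_of_eq_zero _ _ _ _ an an]
      refine toeplitzForm_congr ?_ ?_ <;> intro i hi <;> simp [a, hi]
    have hss : toeplitzForm μ.moment (n + 1) s s =
        toeplitzForm μ.moment n (fun i => R i x) (fun i => R i x) := toeplitzForm_shift _ _ _ _
    have hpp : toeplitzForm μ.moment (n + 1) p p = inner ℂ (R n x) (μ.moment 0 (R n x)) := by
      rw [toeplitzForm_single _ _ _ _ n.lt_succ_self n.lt_succ_self, sub_self]
    have hps : 2 * w * toeplitzForm μ.moment (n + 1) p s = inner ℂ (R n x) (Z x) := by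
      have h1 : toeplitzForm μ.moment (n + 1) p s = ∑ j ∈ Finset.range (n + 1),
          inner ℂ (R n x) (μ.moment ((n : ℤ) - j) (s j)) := by
        rw [toeplitzForm, Finset.sum_eq_single n]
        · simp [p]
        · intro b _ hb
          simp [p, hb]
        · simp
      rw [h1, ← inner_sum, ← inner_smul_right]
      simp only [Z, _root_.smul_apply, _root_.sum_apply]
      congr 2
      refine Finset.sum_congr rfl fun j _ => ?_
      rcases j with _ | j <;> simp [s, shiftSeq]
    rw [toeplitzForm_sub_left, toeplitzForm_sub_right, toeplitzForm_sub_right,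
      ← conj_toeplitzForm _ a v hM, hav, hvv, haa, toeplitzForm_sub_left,
      toeplitzForm_sub_right, toeplitzForm_sub_right, toeplitzForm_smul_left,
      toeplitzForm_smul_right, toeplitzForm_smul_right, toeplitzForm_smul_left,
      ← conj_toeplitzForm _ p s hM, hss, hpp] at e1
    have hq := hμ.toeplitzForm_nonneg n (fun i => R i x)
    set q := toeplitzForm μ.moment n (fun i => R i x) (fun i => R i x)
    set t := toeplitzForm μ.moment (n + 1) p s
    have e2 := congrArg Complex.re e1
    have h3 : (w * (starRingEnd ℂ w * q)).re = ‖w‖ ^ 2 * q.re := by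
      rw [← mul_assoc, Complex.mul_conj, Complex.re_ofReal_mul,
        Complex.normSq_eq_norm_sq]
    have h4 : (starRingEnd ℂ w * starRingEnd ℂ t).re = (w * t).re := by
      rw [← map_mul, Complex.conj_re]
    have h5 : (inner ℂ (R n x) (Z x)).re = 2 * (w * t).re := by
      rw [← hps, mul_assoc]
      simp
    have h6 : ‖w‖ ^ 2 * q.re ≤ q.re := by
      have : ‖w‖ ^ 2 ≤ 1 := by nlinarith [norm_nonneg w]
      nlinarith
    simp only [map_zero, sub_zero, Complex.sub_re, h3, h4, zero_sub, Complex.neg_re] at e2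
    have h7 : (inner ℂ x (κ x)).re ≤ (inner ℂ (R n x) ((μ.moment 0 * R n - Z) x)).re := by
      simp only [_root_.sub_apply, inner_sub_right, Complex.sub_re, h5, _root_.mul_apply_eq_comp]
      linarith
    refine (hκ x).trans (h7.trans ((Complex.re_le_norm _).trans ((norm_inner_le_norm _ _).trans ?_)))
    gcongr
    exact ContinuousLinearMap.le_opNorm _ _
  set K := ‖μ.moment 0 * R n - Z‖
  have hK : 0 ≤ K := norm_nonneg _
  refine ⟨c / (K + 1), by positivity, fun x => ?_⟩
  change _ ≤ ‖R n x‖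
  rcases (norm_nonneg x).eq_or_lt with hx | hx
  · rw [← hx, mul_zero]
    positivity
  rw [div_mul_eq_mul_div, div_le_iff₀ (by positivity)]
  have h1 : c * ‖x‖ ≤ ‖R n x‖ * K := by
    refine le_of_mul_le_mul_right ?_ hx
    linarith [key x]
  nlinarith [norm_nonneg (R n x)]

end OpMeasure

/-- Two Toeplitz forms sharing the same monic orthogonal polynomial of degree `n` and the same
squared norm have the same moments up to order `n`. -/
theorem OpMeasure.moment_eq_of_isMonicOrthR {μ ν : OpMeasure H} (hμ : μ.IsNontrivial) {n : ℕ}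
    {P : (H →L[ℂ] H)[X]} {κ : H →L[ℂ] H} (hP : IsMonicOrthR μ.moment n P κ)
    (hP' : IsMonicOrthR ν.moment n P κ) {k : ℤ} (hk : |k| ≤ n) : ν.moment k = μ.moment k := by
  rcases n with _ | m
  · obtain rfl : k = 0 := abs_eq_zero.1 (le_antisymm (by exact_mod_cast hk) (abs_nonneg k))
    have e1 := hP.sum_eq 0 le_rfl (by simp)
    have e2 := hP'.sum_eq 0 le_rfl (by simp)
    simp only [zero_add, Finset.range_one, Finset.sum_singleton, hP.coeff_self, mul_one,
      Nat.cast_zero, sub_zero, if_true] at e1 e2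
    rw [e1, e2]
  let S : (ℕ → H) → ℕ → H := fun f => shiftSeq f - fun i => P.coeff i (f m)
  have hS : ∀ {ρ : OpMeasure H}, IsMonicOrthR ρ.moment (m + 1) P κ → ∀ f g,
      toeplitzForm ρ.moment (m + 1) (S f) (S g) =
        toeplitzForm ρ.moment (m + 1) f g - starRingEnd ℂ (inner ℂ (g m) (κ (f m))) := by
    intro ρ hρ f g
    have hS0 : ∀ f, S f (m + 1) = 0 := fun f => by simp [S, shiftSeq, hρ.coeff_self]
    rw [← toeplitzForm_succ_of_eq_zero _ _ _ _ (hS0 f) (hS0 g), toeplitzForm_sub_left,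
      toeplitzForm_sub_right, toeplitzForm_sub_right, toeplitzForm_shift, hρ.toeplitzForm_right,
      hρ.toeplitzForm_right, ← conj_toeplitzForm _ (shiftSeq g) _ ρ.star_moment,
      hρ.toeplitzForm_right]
    simp [shiftSeq, hρ.coeff_self]
  have hlim : ∀ f : ℕ → H, ∀ i, i < m + 1 → Tendsto (fun k => S^[k] f i) atTop (𝓝 0) := by
    intro f
    obtain ⟨c, hc, hκ⟩ := hμ.le_inner_kappa hP
    let a : ℕ → ℝ := fun k => (toeplitzForm μ.moment (m + 1) (S^[k] f) (S^[k] f)).re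
    have hstep : ∀ k, a (k + 1) = a k - (inner ℂ (S^[k] f m) (κ (S^[k] f m))).re := by
      intro k
      simp only [a, Function.iterate_succ_apply', hS hP, Complex.sub_re, Complex.conj_re]
    have hanti : Antitone a := antitone_nat_of_succ_le fun k => by
      have := (by positivity : 0 ≤ c * ‖S^[k] f m‖ ^ 2).trans (hκ _)
      linarith [hstep k]
    have ha : Tendsto a atTop (𝓝 (⨅ i, a i)) := tendsto_atTop_ciInf hanti
      ⟨0, by rintro _ ⟨k, rfl⟩; exact hμ.toeplitzForm_nonneg _ _⟩
    have hdiff : Tendsto (fun k => c⁻¹ * (a k - a (k + 1))) atTop (𝓝 0) := by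
      simpa using (ha.sub ((tendsto_add_atTop_iff_nat 1).2 ha)).const_mul c⁻¹
    have hm : Tendsto (fun k => S^[k] f m) atTop (𝓝 0) := by
      rw [tendsto_zero_iff_norm_tendsto_zero]
      have h2 : Tendsto (fun k => ‖S^[k] f m‖ ^ 2) atTop (𝓝 0) := by
        refine squeeze_zero (fun k => by positivity) (fun k => ?_) hdiff
        rw [hstep, sub_sub_cancel, inv_mul_eq_div, le_div_iff₀ hc, mul_comm]
        exact hκ _
      simpa using h2.sqrt
    intro i
    induction i with
    | zero =>
      intro _
      rw [← tendsto_add_atTop_iff_nat 1]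
      simp only [Function.iterate_succ_apply']
      have := ((P.coeff 0).continuous.tendsto 0).comp hm
      simpa [S, shiftSeq, Function.comp_def] using this.neg
    | succ i ih =>
      intro hi
      rw [← tendsto_add_atTop_iff_nat 1]
      simp only [Function.iterate_succ_apply']
      have := ((P.coeff (i + 1)).continuous.tendsto 0).comp hm
      simpa [S, shiftSeq, Function.comp_def] using (ih (by omega)).sub this
  have hform0 : ∀ (ρ : OpMeasure H) (f g : ℕ → H),
      Tendsto (fun k => toeplitzForm ρ.moment (m + 1) (S^[k] f) (S^[k] g)) atTop (𝓝 0) := by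
    intro ρ f g
    have : (0 : ℂ) = ∑ i ∈ Finset.range (m + 1), ∑ j ∈ Finset.range (m + 1),
        inner ℂ (0 : H) (ρ.moment ((i : ℤ) - j) 0) := by simp
    rw [this]
    refine tendsto_finsetSum _ fun i hi => tendsto_finsetSum _ fun j hj => ?_
    exact (hlim f i (Finset.mem_range.1 hi)).inner
      (((ρ.moment _).continuous.tendsto 0).comp (hlim g j (Finset.mem_range.1 hj)))
  have heq : ∀ f g, toeplitzForm ν.moment (m + 1) f g = toeplitzForm μ.moment (m + 1) f g := by
    intro f g
    have hconst : ∀ k, toeplitzForm ν.moment (m + 1) (S^[k] f) (S^[k] g) -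
        toeplitzForm μ.moment (m + 1) (S^[k] f) (S^[k] g) =
        toeplitzForm ν.moment (m + 1) f g - toeplitzForm μ.moment (m + 1) f g := by
      intro k
      induction k with
      | zero => rfl
      | succ k ih =>
        rw [← ih]
        simp only [Function.iterate_succ_apply', hS hP, hS hP']
        ring
    have h1 := (hform0 ν f g).sub (hform0 μ f g)
    simp only [hconst, sub_zero] at h1
    exact sub_eq_zero.1 (tendsto_nhds_unique tendsto_const_nhds h1)
  have hle : ∀ i j : ℕ, i < m + 1 → j < m + 1 → ν.moment ((i : ℤ) - j) = μ.moment (i - j) := by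
    intro i j hi hj
    ext y
    refine ext_inner_left ℂ fun x => ?_
    rw [← toeplitzForm_single _ _ i j hi hj, ← toeplitzForm_single _ _ i j hi hj, heq]
  have hneg : ∀ j : ℕ, j ≤ m + 1 → ν.moment (-j) = μ.moment (-j) := by
    intro j hj
    rcases hj.lt_or_eq with hj | rfl
    · simpa using hle 0 j (by omega) hj
    have e1 := hP.sum_eq 0 le_rfl (by positivity)
    have e2 := hP'.sum_eq 0 le_rfl (by positivity)
    rw [if_neg (by positivity), Finset.sum_range_succ, hP.coeff_self, mul_one] at e1 e2
    rw [← zero_sub, eq_neg_of_add_eq_zero_right e1, eq_neg_of_add_eq_zero_right e2]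
    congr 1
    refine Finset.sum_congr rfl fun j hj => ?_
    rw [show (0 : ℤ) - j = (0 : ℕ) - j by simp, hle 0 j (by omega) (Finset.mem_range.1 hj)]
  rcases le_total 0 k with h0 | h0
  · lift k to ℕ using h0
    rw [← neg_neg (k : ℤ), ← star_moment ν, ← star_moment μ,
      hneg k (by rw [abs_le] at hk; omega)]
  · have := hneg k.natAbs (by rw [abs_le] at hk; omega)
    rwa [show (-(k.natAbs : ℤ)) = k by omega] at this

/-- A continuous family of operators over a connected space, each of them bounded below, that is
invertible at one point is invertible everywhere. -/
theorem isUnit_of_preconnectedSpace {X : Type*} [TopologicalSpace X] [PreconnectedSpace X]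
    {F : X → H →L[ℂ] H} (hF : Continuous F)
    (hb : ∀ x, ∃ c : ℝ, 0 < c ∧ ∀ h, c * ‖h‖ ≤ ‖F x h‖) {x₀ : X} (h₀ : IsUnit (F x₀)) (x : X) :
    IsUnit (F x) := by
  have hopen : IsOpen {x | IsUnit (F x)} := Units.isOpen.preimage hF
  have hclosed : IsClosed {x | IsUnit (F x)} := by
    refine isClosed_of_closure_subset fun x hx => ?_
    obtain ⟨c, hc, hcx⟩ := hb x
    obtain ⟨y, hy, u, hu⟩ := mem_closure_iff_nhds.1 hx {y | ‖F x - F y‖ < c / 4} <| by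
      have : Tendsto (fun y => ‖F x - F y‖) (𝓝 x) (𝓝 ‖F x - F x‖) :=
        ((continuous_const.sub hF).norm.tendsto x)
      rw [sub_self, norm_zero] at this
      exact this.eventually_lt_const (by positivity)
    rw [Set.mem_ofPred_eq, ← hu] at hy
    have hinv : ‖(↑u⁻¹ : H →L[ℂ] H)‖ ≤ 2 / c := by
      refine ContinuousLinearMap.opNorm_le_bound _ (by positivity) fun h => ?_
      set g := (↑u⁻¹ : H →L[ℂ] H) h
      have hg : (u : H →L[ℂ] H) g = h := by
        rw [← _root_.mul_apply_eq_comp, Units.mul_inv, _root_.one_apply_eq_self]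
      have h1 : ‖F x g - h‖ ≤ c / 4 * ‖g‖ := by
        rw [← hg, ← _root_.sub_apply]
        exact (ContinuousLinearMap.le_opNorm _ _).trans (by gcongr)
      have h2 := norm_sub_norm_le (F x g) h
      rw [div_mul_eq_mul_div, le_div_iff₀ hc]
      have := hcx g
      nlinarith [norm_nonneg g]
    have h1 : F x = u * (1 - (↑u⁻¹ : H →L[ℂ] H) * (u - F x)) := by
      rw [mul_sub, ← mul_assoc, Units.mul_inv, mul_one, one_mul, sub_sub_cancel]
    rw [Set.mem_ofPred_eq, h1]
    refine u.isUnit.mul (isUnit_one_sub_of_norm_lt_one ?_)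
    calc ‖(↑u⁻¹ : H →L[ℂ] H) * (u - F x)‖ ≤ 2 / c * (c / 4) := by
          refine (norm_mul_le _ _).trans ?_
          rw [norm_sub_rev]
          gcongr
      _ < 1 := by
          field_simp
          norm_num
  have := IsClopen.eq_univ ⟨hclosed, hopen⟩ ⟨x₀, h₀⟩
  exact this.ge (Set.mem_univ x)

/-- The reversed orthogonal polynomial is invertible on the closed unit disc. -/
theorem OpMeasure.IsNontrivial.isUnit_reverse {μ : OpMeasure H} (hμ : μ.IsNontrivial) {n : ℕ}
    {P : (H →L[ℂ] H)[X]} {κ : H →L[ℂ] H} (hP : IsMonicOrthR μ.moment n P κ) {w : ℂ}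
    (hw : ‖w‖ ≤ 1) : IsUnit (∑ j ∈ Finset.range (n + 1), w ^ (n - j) • P.coeff j) := by
  let F : Metric.closedBall (0 : ℂ) 1 → H →L[ℂ] H := fun w =>
    ∑ j ∈ Finset.range (n + 1), (w : ℂ) ^ (n - j) • P.coeff j
  have : PreconnectedSpace (Metric.closedBall (0 : ℂ) 1) :=
    Subtype.preconnectedSpace (convex_closedBall 0 1).isPreconnected
  refine isUnit_of_preconnectedSpace (F := F) (by fun_prop)
    (fun w => hμ.le_norm_reverse hP (mem_closedBall_zero_iff.1 w.2)) (x₀ := ⟨0, by simp⟩) ?_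
    ⟨w, by simpa using hw⟩
  have : F ⟨0, by simp⟩ = 1 := by
    simp only [F]
    rw [Finset.sum_range_succ, Finset.sum_eq_zero, hP.coeff_self]
    · simp
    · intro j hj
      have := Finset.mem_range.1 hj
      simp [zero_pow (show n - j ≠ 0 by omega)]
  rw [this]
  exact isUnit_one

/-- The mean value property for functions holomorphic on the closed unit disc. -/
theorem integral_circleMeasure_of_differentiableAt {E : Type*} [NormedAddCommGroup E]
    [NormedSpace ℂ E] [CompleteSpace E] {f : ℂ → E}
    (hf : ∀ z, ‖z‖ ≤ 1 → DifferentiableAt ℂ f z) :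
    ∫ z : Circle, f z ∂circleMeasure = f 0 := by
  have hd : DiffContOnCl ℂ f (Metric.ball 0 |1|) := by
    refine DifferentiableOn.diffContOnCl fun z hz => (hf z ?_).differentiableWithinAt
    rw [closure_ball _ (by simp)] at hz
    simpa using hz
  rw [← hd.circleAverage, Real.circleAverage_eq_integral_add (-Real.pi), circleMeasure,
    integral_smul_measure, ENNReal.toReal_ofReal (by positivity)]
  congr 1
  have hemb : Continuous fun z : Circle => f z := by
    rw [continuous_iff_continuousAt]
    intro z
    exact ((hf z (Circle.norm_coe z).le).continuousAt).comp (f := fun z : Circle => (z : ℂ))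
      (by fun_prop)
  rw [integral_map (by fun_prop) hemb.aestronglyMeasurable,
    ← intervalIntegral.integral_of_le (by linarith [Real.pi_pos]),
    intervalIntegral.integral_comp_add_right (fun θ ↦ f (circleMap 0 1 θ))]
  rw [zero_add, show 2 * Real.pi + -Real.pi = Real.pi by ring]
  simp [circleMap]

instance : IsProbabilityMeasure circleMeasure := ⟨by
  rw [circleMeasure, Measure.smul_apply, Measure.map_apply (by fun_prop) MeasurableSet.univ]
  simp only [Set.preimage_univ, Measure.restrict_apply_univ, Real.volume_Ioc, smul_eq_mul]
  rw [← ENNReal.ofReal_mul (by positivity), ← ENNReal.ofReal_one]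
  congr 1
  field_simp
  ring⟩

theorem integrable_circleMeasure {E : Type*} [NormedAddCommGroup E] {f : Circle → E}
    (hf : Continuous f) : Integrable f circleMeasure :=
  hf.integrable_of_hasCompactSupport (HasCompactSupport.of_compactSpace f)

theorem continuous_circle_zpow (k : ℤ) : Continuous fun z : Circle => (z : ℂ) ^ k :=
  (by fun_prop : Continuous fun z : Circle => (z : ℂ)).zpow₀ k
    fun z => Or.inl (Circle.coe_ne_zero z)

theorem continuous_zpow_smul {W : Circle → H →L[ℂ] H} (hW : Continuous W) (k : ℤ) :
    Continuous fun z : Circle => (z : ℂ) ^ k • W z :=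
  (continuous_circle_zpow k).smul hW

theorem inner_integral_apply {m : Measure Circle} {W : Circle → H →L[ℂ] H} (hW : Integrable W m)
    (x y : H) : inner ℂ x ((∫ z, W z ∂m) y) = ∫ z, inner ℂ x (W z y) ∂m := by
  rw [ContinuousLinearMap.integral_apply hW]
  exact ((innerSL ℂ x).integral_comp_comm
    (hW.apply_continuousLinearMap y)).symm

namespace OpMeasure

/-- The scalar measure with density `⟪x, W x⟫` with respect to `dθ / 2π`. -/
def densityScalar (W : Circle → H →L[ℂ] H) (x : H) : Measure Circle :=
  circleMeasure.withDensity fun z => ENNReal.ofReal (inner ℂ x (W z x)).re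

section Density

variable {W : Circle → H →L[ℂ] H} (hW : Continuous W) (hpos : ∀ z, (W z).IsPositive)
include hW

theorem isFiniteMeasure_densityScalar (x : H) : IsFiniteMeasure (densityScalar W x) := by
  have hc : Continuous fun z => (inner ℂ x (W z x)).re := by fun_prop
  exact isFiniteMeasure_withDensity_ofReal (integrable_circleMeasure hc).2

include hpos

theorem inner_setIntegral_eq_densityScalar (x : H) {σ : Set Circle} (hσ : MeasurableSet σ) :
    inner ℂ ((∫ z in σ, W z ∂circleMeasure) x) x = ((densityScalar W x).real σ : ℂ) := by
  have hc : Continuous fun z => (inner ℂ x (W z x)).re := by fun_prop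
  have h1 : ∀ z, inner ℂ x (W z x) = ((inner ℂ x (W z x)).re : ℂ) := fun z =>
    Complex.ext rfl (Complex.nonneg_iff.1 ((hpos z).inner_nonneg_right x)).2.symm
  rw [← inner_conj_symm, inner_integral_apply (integrable_circleMeasure hW).integrableOn,
    integral_congr_ae (Eventually.of_forall h1), integral_complex_ofReal, Complex.conj_ofReal,
    densityScalar, Measure.real, withDensity_apply _ hσ, ← ofReal_integral_eq_lintegral_ofReal
      (integrable_circleMeasure hc).integrableOn (Eventually.of_forall fun z =>
        (Complex.nonneg_iff.1 ((hpos z).inner_nonneg_right x)).1), ENNReal.toReal_ofReal]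
  exact integral_nonneg fun z => (Complex.nonneg_iff.1 ((hpos z).inner_nonneg_right x)).1

/-- The operator measure with a given continuous positive density. -/
def ofDensity : OpMeasure H where
  toFun σ := open Classical in if MeasurableSet σ then ∫ z in σ, W z ∂circleMeasure else 0
  toFun_of_not_measurable σ hσ := if_neg hσ
  exists_scalar x := ⟨densityScalar W x, isFiniteMeasure_densityScalar hW x, fun σ hσ => by
    rw [if_pos hσ, inner_setIntegral_eq_densityScalar hW hpos x hσ]⟩

theorem ofDensity_apply {σ : Set Circle} (hσ : MeasurableSet σ) :
    ofDensity hW hpos σ = ∫ z in σ, W z ∂circleMeasure := if_pos hσ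

theorem hasDensity_ofDensity : (ofDensity hW hpos).HasDensity W :=
  ⟨integrable_circleMeasure hW, fun _ hσ => ofDensity_apply hW hpos hσ⟩

theorem scalar_ofDensity (x : H) : (ofDensity hW hpos).scalar x = densityScalar W x := by
  have := isFiniteMeasure_densityScalar hW x
  refine Measure.ext fun σ hσ => ?_
  rw [← ENNReal.toReal_eq_toReal_iff' (measure_ne_top _ _) (measure_ne_top _ _)]
  have h1 := (ofDensity hW hpos).inner_apply x hσ
  rw [ofDensity_apply hW hpos hσ, inner_setIntegral_eq_densityScalar hW hpos x hσ] at h1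
  exact (Complex.ofReal_injective h1).symm

theorem moment_ofDensity (k : ℤ) :
    (ofDensity hW hpos).moment k = ∫ z : Circle, (z : ℂ) ^ (-k) • W z ∂circleMeasure := by
  refine ext_inner_self fun x => ?_
  have hc : Continuous fun z => (inner ℂ x (W z x)).re := by fun_prop
  rw [inner_moment, scalar_ofDensity, densityScalar, integral_withDensity_eq_integral_toReal_smul
    hc.measurable.ennreal_ofReal (Eventually.of_forall fun _ => ENNReal.ofReal_lt_top),
    inner_integral_apply (integrable_circleMeasure (continuous_zpow_smul hW _))]
  refine integral_congr_ae (Eventually.of_forall fun z => ?_)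
  have h0 := Complex.nonneg_iff.1 ((hpos z).inner_nonneg_right x)
  have h1 : inner ℂ x (W z x) = ((inner ℂ x (W z x)).re : ℂ) := Complex.ext rfl h0.2.symm
  simp only [ENNReal.toReal_ofReal h0.1, _root_.smul_apply, inner_smul_right]
  rw [mul_comm, h1, Complex.ofReal_re, Complex.real_smul]

end Density

theorem integral_circle_zpow (k : ℤ) :
    ∫ z : Circle, (z : ℂ) ^ k ∂circleMeasure = if k = 0 then 1 else 0 := by
  have h : ∀ m : ℕ, ∫ z : Circle, (z : ℂ) ^ m ∂circleMeasure = if m = 0 then 1 else 0 := by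
    intro m
    rw [integral_circleMeasure_of_differentiableAt (f := fun z => z ^ m) (by fun_prop)]
    simp [zero_pow_eq]
  obtain ⟨m, rfl | rfl⟩ := k.eq_nat_or_neg
  · simpa using h m
  · have h1 := congrArg (starRingEnd ℂ) (h m)
    rw [← integral_conj] at h1
    have h2 : ∀ z : Circle, (starRingEnd ℂ) ((z : ℂ) ^ m) = (z : ℂ) ^ (-(m : ℤ)) := by
      intro z
      rw [map_pow, ← Circle.coe_inv_eq_conj, Circle.coe_inv, inv_pow, zpow_neg, zpow_natCast]
    simp only [h2] at h1
    rw [h1]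
    by_cases hm : m = 0 <;> simp [hm]

theorem re_sum_inner_nonneg {W : Circle → H →L[ℂ] H} (hW : Continuous W)
    (hpos : ∀ z x, 0 ≤ (inner ℂ x (W z x)).re) {N : ℕ} (v : Fin N → H) :
    0 ≤ (∑ i : Fin N, ∑ j : Fin N, inner ℂ (v i)
      ((∫ z : Circle, (z : ℂ) ^ (-((i : ℤ) - j)) • W z ∂circleMeasure) (v j))).re := by
  have hi : ∀ i j : Fin N, Integrable (fun z : Circle =>
      inner ℂ (v i) (((z : ℂ) ^ (-((i : ℤ) - j)) • W z) (v j))) circleMeasure := fun i j =>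
    integrable_circleMeasure <| Continuous.inner continuous_const <|
      (continuous_zpow_smul hW _).clm_apply continuous_const
  have h1 : (∑ i : Fin N, ∑ j : Fin N, inner ℂ (v i)
      ((∫ z : Circle, (z : ℂ) ^ (-((i : ℤ) - j)) • W z ∂circleMeasure) (v j))) =
      ∫ z : Circle, inner ℂ (∑ i : Fin N, (z : ℂ) ^ (i : ℕ) • v i)
        (W z (∑ i : Fin N, (z : ℂ) ^ (i : ℕ) • v i)) ∂circleMeasure := by
    simp only [inner_integral_apply (integrable_circleMeasure (continuous_zpow_smul hW _))]
    have h2 : ∀ i : Fin N, ∑ j : Fin N, ∫ z : Circle, inner ℂ (v i) (((z : ℂ) ^ (-((i : ℤ) - j)) • W z) (v j))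
        ∂circleMeasure = ∫ z : Circle, ∑ j : Fin N,
          inner ℂ (v i) (((z : ℂ) ^ (-((i : ℤ) - j)) • W z) (v j)) ∂circleMeasure := fun i =>
      (integral_finsetSum _ fun j _ => hi i j).symm
    simp only [h2]
    rw [← integral_finsetSum _ fun i _ => integrable_finsetSum _ fun j _ => hi i j]
    refine integral_congr_ae (Eventually.of_forall fun z => ?_)
    simp only [map_sum, map_smul, sum_inner, inner_sum, inner_smul_left, inner_smul_right,
      _root_.smul_apply, Finset.mul_sum]
    rw [Finset.sum_comm]
    refine Finset.sum_congr rfl fun j _ => Finset.sum_congr rfl fun i _ => ?_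
    rw [← mul_assoc, map_pow, ← Circle.coe_inv_eq_conj, Circle.coe_inv, neg_sub,
      zpow_sub₀ (Circle.coe_ne_zero z), zpow_natCast, zpow_natCast, div_eq_mul_inv, inv_pow,
      mul_comm (_ ^ (j : ℕ))]
  rw [h1, ← RCLike.re_eq_complex_re, ← integral_re]
  · exact integral_nonneg fun z => hpos _ _
  · exact integrable_circleMeasure (by fun_prop)

theorem isNontrivial_ofDensity {W : Circle → H →L[ℂ] H} (hW : Continuous W)
    (hpos : ∀ z, (W z).IsPositive) {c : ℝ} (hc : 0 < c)
    (hle : ∀ z x, c * ‖x‖ ^ 2 ≤ (inner ℂ x (W z x)).re) : (ofDensity hW hpos).IsNontrivial := by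
  intro N
  refine ⟨c, hc, fun v => ?_⟩
  have h0 := re_sum_inner_nonneg (W := fun z => W z - (c : ℂ) • 1) (by fun_prop) (fun z x => by
    have h2 := hle z x
    simp only [_root_.sub_apply, _root_.smul_apply, _root_.one_apply_eq_self, inner_sub_right,
      inner_smul_right, inner_self_eq_norm_sq_to_K, Complex.sub_re]
    have : ((c : ℂ) * ((‖x‖ : ℝ) : ℂ) ^ 2).re = c * ‖x‖ ^ 2 := by
      rw [← Complex.ofReal_pow, ← Complex.ofReal_mul, Complex.ofReal_re]
    change 0 ≤ _ - ((c : ℂ) * ((‖x‖ : ℝ) : ℂ) ^ 2).re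
    rw [this]
    linarith) v
  have h1 : ∀ i j : Fin N, (∫ z : Circle, (z : ℂ) ^ (-((i : ℤ) - j)) •
      (W z - (c : ℂ) • (1 : H →L[ℂ] H)) ∂circleMeasure) =
      (ofDensity hW hpos).moment ((i : ℤ) - j) - if i = j then (c : ℂ) • 1 else 0 := by
    intro i j
    simp only [smul_sub]
    rw [integral_sub (integrable_circleMeasure (continuous_zpow_smul hW _))
      (integrable_circleMeasure (continuous_zpow_smul continuous_const _)),
      moment_ofDensity, integral_smul_const, integral_circle_zpow]
    congr 1
    have : -((i : ℤ) - j) = 0 ↔ i = j := by omega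
    simp only [this]
    split_ifs <;> simp
  simp only [h1, _root_.sub_apply, inner_sub_right, Finset.sum_sub_distrib, Complex.sub_re] at h0
  have h2 : (∑ i : Fin N, ∑ j : Fin N,
      inner ℂ (v i) ((if i = j then (c : ℂ) • (1 : H →L[ℂ] H) else 0) (v j))).re =
      c * ∑ j, ‖v j‖ ^ 2 := by
    rw [Complex.re_sum, Finset.mul_sum]
    refine Finset.sum_congr rfl fun i _ => ?_
    rw [Finset.sum_eq_single i (fun j _ hj => by simp [hj.symm]) (by simp), if_pos rfl]
    simp only [_root_.smul_apply, _root_.one_apply_eq_self, inner_smul_right,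
      inner_self_eq_norm_sq_to_K]
    change ((c : ℂ) * ((‖v i‖ : ℝ) : ℂ) ^ 2).re = _
    rw [← Complex.ofReal_pow, ← Complex.ofReal_mul, Complex.ofReal_re]
  linarith

end OpMeasure

theorem evalAt_mul (P Q : (H →L[ℂ] H)[X]) (z : Circle) :
    evalAt (P * Q) z = evalAt P z * evalAt Q z :=
  map_mul (eval₂RingHom' (RingHom.id (H →L[ℂ] H)) (algebraMap ℂ (H →L[ℂ] H) (z : ℂ))
    fun a => (Algebra.commutes _ a).symm) P Q

theorem evalAt_C (A : H →L[ℂ] H) (z : Circle) : evalAt (C A) z = A := eval_C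

theorem evalAt_X_pow (k : ℕ) (z : Circle) :
    evalAt (X ^ k : (H →L[ℂ] H)[X]) z = (z : ℂ) ^ k • 1 := by
  rw [evalAt, eval_X_pow, ← map_pow, Algebra.algebraMap_eq_smul_one]

theorem evalAt_eq_sum {P : (H →L[ℂ] H)[X]} {n : ℕ} (hP : ∀ i, n < i → P.coeff i = 0)
    (z : Circle) : evalAt P z = ∑ j ∈ Finset.range (n + 1), (z : ℂ) ^ j • P.coeff j := by
  rw [evalAt, eval_eq_sum_range' (n := n + 1)]
  · refine Finset.sum_congr rfl fun j _ => ?_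
    rw [← map_pow, Algebra.smul_def, Algebra.commutes]
  · exact Nat.lt_succ_iff.2 (natDegree_le_iff_coeff_eq_zero.2 fun i hi => hP i (by simpa using hi))

theorem continuous_evalAt (P : (H →L[ℂ] H)[X]) : Continuous (evalAt P) := by
  have : evalAt P = fun z : Circle => ∑ j ∈ Finset.range (P.natDegree + 1),
      (z : ℂ) ^ j • P.coeff j :=
    funext fun z => evalAt_eq_sum (fun i hi => coeff_eq_zero_of_natDegree_lt hi) z
  rw [this]
  fun_prop

theorem continuous_ringInverse_comp {X : Type*} [TopologicalSpace X] {F : X → H →L[ℂ] H}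
    (hF : Continuous F) (hu : ∀ x, IsUnit (F x)) : Continuous fun x => Ring.inverse (F x) := by
  rw [continuous_iff_continuousAt]
  intro x
  obtain ⟨u, hux⟩ := hu x
  have h := NormedRing.inverse_continuousAt u
  rw [hux] at h
  exact h.comp (f := F) hF.continuousAt

/-- The adjoint of the reversed polynomial, `z ↦ ∑_{j ≤ n} z^{n-j} c_j†` for
`P = ∑_{j ≤ n} z^j c_j`. -/
def adjReverse (P : (H →L[ℂ] H)[X]) (n : ℕ) (z : ℂ) : H →L[ℂ] H :=
  ∑ j ∈ Finset.range (n + 1), z ^ (n - j) • star (P.coeff j)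

section Reverse

variable {μ : OpMeasure H} (hμ : μ.IsNontrivial) {n : ℕ} {P : (H →L[ℂ] H)[X]} {κ : H →L[ℂ] H}
  (hP : IsMonicOrthR μ.moment n P κ)
include hP

theorem IsMonicOrthR.adjReverse_zero : adjReverse P n 0 = 1 := by
  rw [adjReverse, Finset.sum_range_succ, Finset.sum_eq_zero, hP.coeff_self]
  · simp
  · intro j hj
    have := Finset.mem_range.1 hj
    simp [zero_pow (show n - j ≠ 0 by omega)]

theorem IsMonicOrthR.star_evalAt (z : Circle) :
    star (evalAt P z) = (z : ℂ) ^ (-(n : ℤ)) • adjReverse P n z := by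
  rw [evalAt_eq_sum hP.coeff_of_lt, star_sum, adjReverse, Finset.smul_sum]
  refine Finset.sum_congr rfl fun j hj => ?_
  have hz := Circle.coe_ne_zero z
  rw [star_smul, smul_smul, star_pow, RCLike.star_def, ← Circle.coe_inv_eq_conj, Circle.coe_inv,
    ← zpow_natCast (z : ℂ) (n - j), ← zpow_add₀ hz, inv_pow, ← zpow_natCast, ← zpow_neg,
    Nat.cast_sub (Finset.mem_range_succ_iff.1 hj)]
  congr 2
  ring

include hμ

theorem IsMonicOrthR.isUnit_adjReverse {z : ℂ} (hz : ‖z‖ ≤ 1) : IsUnit (adjReverse P n z) := by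
  have h := (hμ.isUnit_reverse hP (w := starRingEnd ℂ z) (by simpa using hz)).star
  rw [star_sum] at h
  simpa [adjReverse, star_smul] using h

theorem IsMonicOrthR.isUnit_evalAt (z : Circle) : IsUnit (evalAt P z) := by
  rw [← isUnit_star, hP.star_evalAt]
  exact (hP.isUnit_adjReverse hμ (Circle.norm_coe z).le).smul
    (Units.mk0 _ (zpow_ne_zero _ (Circle.coe_ne_zero z)))

theorem IsMonicOrthR.inverse_star_evalAt (z : Circle) :
    Ring.inverse (star (evalAt P z)) = (z : ℂ) ^ (n : ℤ) • Ring.inverse (adjReverse P n z) := by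
  have hu := hP.isUnit_adjReverse hμ (Circle.norm_coe z).le
  have hx : IsUnit (star (evalAt P z)) := (hP.isUnit_evalAt hμ z).star
  rw [← one_mul (Ring.inverse _), eq_comm, Ring.eq_mul_inverse_iff_mul_eq _ _ _ hx,
    hP.star_evalAt, smul_mul_smul_comm, Ring.inverse_mul_cancel _ hu,
    ← zpow_add₀ (Circle.coe_ne_zero z), add_neg_cancel, zpow_zero, one_smul]

theorem IsMonicOrthR.integral_zpow_smul_inverse (m : ℕ) :
    ∫ z : Circle, (z : ℂ) ^ ((m : ℤ) - n) • Ring.inverse (star (evalAt P z)) ∂circleMeasure =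
      if m = 0 then 1 else 0 := by
  have h1 : ∀ z : Circle, (z : ℂ) ^ ((m : ℤ) - n) • Ring.inverse (star (evalAt P z)) =
      (z : ℂ) ^ m • Ring.inverse (adjReverse P n z) := by
    intro z
    rw [hP.inverse_star_evalAt hμ, smul_smul, ← zpow_add₀ (Circle.coe_ne_zero z), sub_add_cancel,
      zpow_natCast]
  simp only [h1]
  rw [integral_circleMeasure_of_differentiableAt
    (f := fun z => z ^ m • Ring.inverse (adjReverse P n z)), hP.adjReverse_zero]
  · by_cases hm : m = 0 <;> simp [hm]
  · intro z hz
    have h2 : DifferentiableAt ℂ (adjReverse P n) z := by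
      unfold adjReverse
      fun_prop
    have h3 : DifferentiableAt ℂ (fun z => Ring.inverse (adjReverse P n z)) z :=
      (differentiableAt_inverse (hP.isUnit_adjReverse hμ hz)).comp z h2
    fun_prop

end Reverse

theorem IsMonicOrthR.sum_star_mul {M : ℤ → H →L[ℂ] H} (hM : ∀ k, star (M k) = M (-k)) {j k : ℕ}
    {P Q : (H →L[ℂ] H)[X]} {κ l : H →L[ℂ] H} (hP : IsMonicOrthR M j P κ)
    (hQ : IsMonicOrthR M k Q l) :
    ∑ a ∈ Finset.range (j + 1), ∑ b ∈ Finset.range (k + 1),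
      star (P.coeff a) * M ((a : ℤ) - b) * Q.coeff b = if j = k then l else 0 := by
  rcases le_or_gt j k with h | h
  · have h1 : ∀ a ∈ Finset.range (j + 1), ∑ b ∈ Finset.range (k + 1),
        star (P.coeff a) * M ((a : ℤ) - b) * Q.coeff b =
          if a = k then star (P.coeff a) * l else 0 := by
      intro a ha
      have := Finset.mem_range.1 ha
      simp only [mul_assoc, ← Finset.mul_sum]
      rw [hQ.sum_eq a (by simp) (by omega)]
      by_cases hak : a = k <;> simp [hak]
    rw [Finset.sum_congr rfl h1, Finset.sum_range_succ, Finset.sum_eq_zero, hP.coeff_self]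
    · simp
    · intro a ha
      rw [if_neg (by have := Finset.mem_range.1 ha; omega)]
  · rw [if_neg h.ne', Finset.sum_comm]
    refine Finset.sum_eq_zero fun b hb => ?_
    have := Finset.mem_range.1 hb
    have h1 := congrArg star (hP.sum_eq b (by simp) (by omega))
    rw [if_neg (by omega), star_zero, star_sum] at h1
    simp only [star_mul, hM, neg_sub] at h1
    rw [← Finset.sum_mul, h1, zero_mul]

namespace OpMeasure

variable {μ : OpMeasure H} (hμ : μ.IsNontrivial) (n : ℕ)
include hμ

theorem IsNontrivial.isPositive_kappaR : (μ.kappaR n).IsPositive := by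
  have hP := μ.isMonicOrthR_monicR hμ n
  obtain ⟨c, hc, h⟩ := hμ.le_inner_kappa hP
  have h1 : ∀ x, inner ℂ x (μ.kappaR n x) = ((inner ℂ x (μ.kappaR n x)).re : ℂ) := by
    intro x
    have h2 := hP.toeplitzForm_right (fun i => (μ.monicR n).coeff i x) x
    rw [hP.coeff_self, _root_.one_apply_eq_self] at h2
    rw [← h2]
    exact (Complex.conj_eq_iff_re.1 (conj_toeplitzForm _ _ _ μ.star_moment)).symm
  rw [ContinuousLinearMap.isPositive_iff_complex]
  intro x
  rw [← inner_conj_symm, h1]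
  simp only [Complex.conj_ofReal]
  exact ⟨by simp, (by positivity : 0 ≤ c * ‖x‖ ^ 2).trans (by simpa using h x)⟩

theorem IsNontrivial.isUnit_kappaR : IsUnit (μ.kappaR n) := by
  obtain ⟨c, hc, h⟩ := hμ.le_inner_kappa (μ.isMonicOrthR_monicR hμ n)
  refine ContinuousLinearMap.isUnit_of_forall_le_norm_inner_map _ (c := ⟨c, hc.le⟩) hc
    fun x => ?_
  rw [norm_inner_symm, mul_comm]
  exact (h x).trans (Complex.re_le_norm _)

theorem IsNontrivial.kappaR_nonneg : 0 ≤ μ.kappaR n :=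
  (ContinuousLinearMap.nonneg_iff_isPositive _).2 (hμ.isPositive_kappaR n)

theorem IsNontrivial.isUnit_sqrt_kappaR : IsUnit (CFC.sqrt (μ.kappaR n)) :=
  (CFC.isUnit_sqrt_iff _ (hμ.kappaR_nonneg n)).2 (hμ.isUnit_kappaR n)

theorem IsNontrivial.star_sqrt_kappaR : star (CFC.sqrt (μ.kappaR n)) = CFC.sqrt (μ.kappaR n) :=
  (IsSelfAdjoint.of_nonneg (CFC.sqrt_nonneg _)).star_eq

theorem IsNontrivial.sqrt_mul_sqrt_kappaR :
    CFC.sqrt (μ.kappaR n) * CFC.sqrt (μ.kappaR n) = μ.kappaR n :=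
  CFC.sqrt_mul_sqrt_self _ (hμ.kappaR_nonneg n)

theorem evalAt_phiR (z : Circle) : evalAt (μ.phiR n) z =
    evalAt (μ.monicR n) z * Ring.inverse (CFC.sqrt (μ.kappaR n)) := by
  rw [phiR, evalAt_mul, evalAt_C]

theorem IsNontrivial.isUnit_evalAt_phiR (z : Circle) : IsUnit (evalAt (μ.phiR n) z) := by
  rw [evalAt_phiR hμ]
  exact ((μ.isMonicOrthR_monicR hμ n).isUnit_evalAt hμ z).mul
    (hμ.isUnit_sqrt_kappaR n).ringInverse

theorem IsNontrivial.density_eq_star_mul (z : Circle) : bernsteinSzegoDensity μ n z =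
    star (Ring.inverse (evalAt (μ.phiR n) z)) * Ring.inverse (evalAt (μ.phiR n) z) := by
  rw [bernsteinSzegoDensity, Ring.inverse_mul (Or.inl (hμ.isUnit_evalAt_phiR n z)),
    Ring.inverse_star]

theorem IsNontrivial.density_mul_monicR (z : Circle) :
    bernsteinSzegoDensity μ n z * evalAt (μ.monicR n) z =
      Ring.inverse (star (evalAt (μ.monicR n) z)) * μ.kappaR n := by
  have hs := hμ.isUnit_sqrt_kappaR n
  rw [hμ.density_eq_star_mul, evalAt_phiR hμ, Ring.inverse_mul (Or.inr hs.ringInverse),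
    Ring.inverse_inverse hs, mul_assoc, mul_assoc, Ring.inverse_mul_cancel _
      ((μ.isMonicOrthR_monicR hμ n).isUnit_evalAt hμ z), mul_one, star_mul,
    hμ.star_sqrt_kappaR, mul_assoc, hμ.sqrt_mul_sqrt_kappaR, Ring.inverse_star]

theorem IsNontrivial.continuous_density : Continuous (bernsteinSzegoDensity μ n) :=
  continuous_ringInverse_comp ((continuous_evalAt _).mul (continuous_evalAt _).star) fun z =>
    (hμ.isUnit_evalAt_phiR n z).mul (hμ.isUnit_evalAt_phiR n z).star

theorem IsNontrivial.isPositive_density (z : Circle) :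
    (bernsteinSzegoDensity μ n z).IsPositive := by
  rw [hμ.density_eq_star_mul, ← ContinuousLinearMap.nonneg_iff_isPositive]
  exact star_mul_self_nonneg _

theorem IsNontrivial.exists_le_density : ∃ c : ℝ, 0 < c ∧ ∀ z x,
    c * ‖x‖ ^ 2 ≤ (inner ℂ x (bernsteinSzegoDensity μ n z x)).re := by
  obtain ⟨K, hK⟩ := (isCompact_range (continuous_evalAt (μ.phiR n)).norm).bddAbove
  have hK' : ∀ z, ‖evalAt (μ.phiR n) z‖ ≤ K := fun z => hK ⟨z, rfl⟩
  have hK0 : 0 ≤ K := (norm_nonneg _).trans (hK' 1)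
  refine ⟨1 / (K + 1) ^ 2, by positivity, fun z x => ?_⟩
  rw [hμ.density_eq_star_mul, _root_.mul_apply_eq_comp, ContinuousLinearMap.star_eq_adjoint,
    ContinuousLinearMap.adjoint_inner_right, inner_self_eq_norm_sq_to_K]
  set g := Ring.inverse (evalAt (μ.phiR n) z)
  have h1 : evalAt (μ.phiR n) z (g x) = x := by
    rw [← _root_.mul_apply_eq_comp, Ring.mul_inverse_cancel _ (hμ.isUnit_evalAt_phiR n z),
      _root_.one_apply_eq_self]
  have h2 : ‖x‖ ≤ (K + 1) * ‖g x‖ := by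
    calc ‖x‖ = ‖evalAt (μ.phiR n) z (g x)‖ := by rw [h1]
      _ ≤ K * ‖g x‖ := (ContinuousLinearMap.le_opNorm _ _).trans (by gcongr; exact hK' z)
      _ ≤ (K + 1) * ‖g x‖ := by gcongr; linarith
  change _ ≤ (((‖g x‖ : ℝ) : ℂ) ^ 2).re
  rw [← Complex.ofReal_pow, Complex.ofReal_re, one_div_mul_eq_div, div_le_iff₀ (by positivity),
    ← mul_pow, mul_comm]
  gcongr

/-- The Bernstein–Szegő measure. -/
def IsNontrivial.bernsteinSzego : OpMeasure H :=
  ofDensity (hμ.continuous_density n) (hμ.isPositive_density n)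

theorem IsNontrivial.isNontrivial_bernsteinSzego : (hμ.bernsteinSzego n).IsNontrivial := by
  obtain ⟨c, hc, h⟩ := hμ.exists_le_density n
  exact isNontrivial_ofDensity _ _ hc h

theorem IsNontrivial.isMonicOrthR_bernsteinSzego {j : ℕ} (hj : n ≤ j) :
    IsMonicOrthR (hμ.bernsteinSzego n).moment j (X ^ (j - n) * μ.monicR n) (μ.kappaR n) := by
  have hP := μ.isMonicOrthR_monicR hμ n
  have hlt : ∀ i, j < i → (X ^ (j - n) * μ.monicR n).coeff i = 0 := by
    intro i hi
    rw [coeff_X_pow_mul', if_pos (by omega), hP.coeff_of_lt _ (by omega)]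
  refine ⟨?_, hlt, fun i hi0 hij => ?_⟩
  · rw [coeff_X_pow_mul', if_pos (by omega), show j - (j - n) = n by omega, hP.coeff_self]
  have hW := hμ.continuous_density n
  have h1 : ∀ b : ℕ, (hμ.bernsteinSzego n).moment (i - b) * (X ^ (j - n) * μ.monicR n).coeff b =
      ∫ z : Circle, ((z : ℂ) ^ (-(i - b)) • bernsteinSzegoDensity μ n z) *
        (X ^ (j - n) * μ.monicR n).coeff b ∂circleMeasure := by
    intro b
    rw [integral_mul_const_of_integrable (integrable_circleMeasure (continuous_zpow_smul hW _)),
      IsNontrivial.bernsteinSzego, moment_ofDensity]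
  have hint : ∀ b : ℕ, Integrable (fun z : Circle =>
      ((z : ℂ) ^ (-(i - b)) • bernsteinSzegoDensity μ n z) *
        (X ^ (j - n) * μ.monicR n).coeff b) circleMeasure := fun b =>
    integrable_circleMeasure ((continuous_zpow_smul hW _).mul continuous_const)
  rw [Finset.sum_congr rfl fun b _ => h1 b, ← integral_finsetSum _ fun b _ => hint b]
  have h2 : ∀ z : Circle, ∑ b ∈ Finset.range (j + 1),
      ((z : ℂ) ^ (-(i - b)) • bernsteinSzegoDensity μ n z) * (X ^ (j - n) * μ.monicR n).coeff b =
      ((z : ℂ) ^ (((j - i).toNat : ℤ) - n) • Ring.inverse (star (evalAt (μ.monicR n) z))) *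
        μ.kappaR n := by
    intro z
    have hz := Circle.coe_ne_zero z
    have h3 : ∀ b : ℕ, ((z : ℂ) ^ (-(i - b)) • bernsteinSzegoDensity μ n z) *
        (X ^ (j - n) * μ.monicR n).coeff b = (z : ℂ) ^ (-i) • (bernsteinSzegoDensity μ n z *
          ((z : ℂ) ^ b • (X ^ (j - n) * μ.monicR n).coeff b)) := by
      intro b
      rw [mul_smul_comm, smul_smul, smul_mul_assoc, ← zpow_natCast, ← zpow_add₀ hz]
      congr 2
      ring
    rw [Finset.sum_congr rfl fun b _ => h3 b, ← Finset.smul_sum, ← Finset.mul_sum,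
      ← evalAt_eq_sum hlt, evalAt_mul, evalAt_X_pow, smul_mul_assoc, one_mul, mul_smul_comm,
      smul_smul, hμ.density_mul_monicR, smul_mul_assoc, ← zpow_natCast, ← zpow_add₀ hz]
    congr 2
    omega
  rw [integral_congr_ae (Eventually.of_forall h2), integral_mul_const_of_integrable,
    hP.integral_zpow_smul_inverse hμ]
  · by_cases hi : i = j
    · simp [hi]
    · rw [if_neg hi, if_neg (by omega), zero_mul]
  · refine integrable_circleMeasure (continuous_zpow_smul ?_ _)
    exact continuous_ringInverse_comp (continuous_evalAt _).star fun z =>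
      (hP.isUnit_evalAt hμ z).star

end OpMeasure

namespace OpMeasure

theorem integral_star_evalAt_mul {W : Circle → H →L[ℂ] H} (hW : Continuous W)
    (hpos : ∀ z, (W z).IsPositive) {P Q : (H →L[ℂ] H)[X]} {j k : ℕ}
    (hP : ∀ i, j < i → P.coeff i = 0) (hQ : ∀ i, k < i → Q.coeff i = 0) :
    ∫ z, star (evalAt P z) * W z * evalAt Q z ∂circleMeasure =
      ∑ a ∈ Finset.range (j + 1), ∑ b ∈ Finset.range (k + 1),
        star (P.coeff a) * (ofDensity hW hpos).moment ((a : ℤ) - b) * Q.coeff b := by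
  have hc : ∀ a b : ℕ, Continuous fun z : Circle =>
      star (P.coeff a) * ((z : ℂ) ^ (-((a : ℤ) - b)) • W z) := fun a b =>
    continuous_const.mul (continuous_zpow_smul hW _)
  have hint : ∀ a b : ℕ, Integrable (fun z : Circle =>
      star (P.coeff a) * ((z : ℂ) ^ (-((a : ℤ) - b)) • W z) * Q.coeff b) circleMeasure :=
    fun a b => integrable_circleMeasure ((hc a b).mul continuous_const)
  have h1 : ∀ a b : ℕ, star (P.coeff a) * (ofDensity hW hpos).moment ((a : ℤ) - b) * Q.coeff b =
      ∫ z : Circle, star (P.coeff a) * ((z : ℂ) ^ (-((a : ℤ) - b)) • W z) * Q.coeff b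
        ∂circleMeasure := by
    intro a b
    rw [integral_mul_const_of_integrable (integrable_circleMeasure (hc a b)),
      integral_const_mul_of_integrable (integrable_circleMeasure (continuous_zpow_smul hW _)),
      moment_ofDensity]
  have h2 : ∀ a : ℕ, ∑ b ∈ Finset.range (k + 1),
      star (P.coeff a) * (ofDensity hW hpos).moment ((a : ℤ) - b) * Q.coeff b =
      ∫ z : Circle, ∑ b ∈ Finset.range (k + 1),
        star (P.coeff a) * ((z : ℂ) ^ (-((a : ℤ) - b)) • W z) * Q.coeff b ∂circleMeasure := by
    intro a
    rw [integral_finsetSum _ fun b _ => hint a b]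
    exact Finset.sum_congr rfl fun b _ => h1 a b
  rw [Finset.sum_congr rfl fun a _ => h2 a, ← integral_finsetSum _ fun a _ =>
    integrable_finsetSum _ fun b _ => hint a b]
  refine integral_congr_ae (Eventually.of_forall fun z => ?_)
  have hz := Circle.coe_ne_zero z
  simp only [evalAt_eq_sum hP, evalAt_eq_sum hQ, star_sum, Finset.sum_mul, Finset.mul_sum]
  rw [Finset.sum_comm]
  refine Finset.sum_congr rfl fun a _ => Finset.sum_congr rfl fun b _ => ?_
  rw [star_smul, star_pow, RCLike.star_def, ← Circle.coe_inv_eq_conj, Circle.coe_inv,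
    smul_mul_assoc, smul_mul_smul_comm, mul_smul_comm, smul_mul_assoc, neg_sub, zpow_sub₀ hz,
    zpow_natCast, zpow_natCast, inv_pow, div_eq_inv_mul]

theorem coeff_phiR (μ : OpMeasure H) (n k : ℕ) : (μ.phiR n).coeff k =
    (μ.monicR n).coeff k * Ring.inverse (CFC.sqrt (μ.kappaR n)) := by
  rw [phiR, coeff_mul_C]

variable {μ : OpMeasure H} (hμ : μ.IsNontrivial) (n : ℕ)
include hμ

theorem IsNontrivial.sum_star_phiR (j k : ℕ) :
    ∑ a ∈ Finset.range (j + 1), ∑ b ∈ Finset.range (k + 1),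
      star ((μ.phiR j).coeff a) * μ.moment ((a : ℤ) - b) * (μ.phiR k).coeff b =
        if j = k then 1 else 0 := by
  have h := (μ.isMonicOrthR_monicR hμ j).sum_star_mul μ.star_moment (μ.isMonicOrthR_monicR hμ k)
  have h1 : ∀ a b : ℕ, star ((μ.phiR j).coeff a) * μ.moment ((a : ℤ) - b) * (μ.phiR k).coeff b =
      star (Ring.inverse (CFC.sqrt (μ.kappaR j))) * (star ((μ.monicR j).coeff a) *
        μ.moment ((a : ℤ) - b) * (μ.monicR k).coeff b) * Ring.inverse (CFC.sqrt (μ.kappaR k)) := by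
    intro a b
    simp only [coeff_phiR, star_mul, mul_assoc]
  simp only [h1, ← Finset.sum_mul, ← Finset.mul_sum]
  rw [h]
  split_ifs with hjk
  · subst hjk
    have hs := hμ.isUnit_sqrt_kappaR j
    rw [← Ring.inverse_star, hμ.star_sqrt_kappaR]
    nth_rw 2 [← hμ.sqrt_mul_sqrt_kappaR j]
    rw [Ring.inverse_mul_cancel_left _ _ hs, Ring.mul_inverse_cancel _ hs]
  · simp

theorem IsNontrivial.monicR_bernsteinSzego {j : ℕ} (hj : n ≤ j) :
    (hμ.bernsteinSzego n).monicR j = X ^ (j - n) * μ.monicR n ∧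
      (hμ.bernsteinSzego n).kappaR j = μ.kappaR n :=
  (isMonicOrthR_monicR _ (hμ.isNontrivial_bernsteinSzego n) j).unique
    (hμ.isNontrivial_bernsteinSzego n) (hμ.isMonicOrthR_bernsteinSzego n hj)

theorem IsNontrivial.moment_bernsteinSzego {k : ℤ} (hk : |k| ≤ n) :
    (hμ.bernsteinSzego n).moment k = μ.moment k := by
  refine moment_eq_of_isMonicOrthR hμ (μ.isMonicOrthR_monicR hμ n) ?_ hk
  simpa using hμ.isMonicOrthR_bernsteinSzego n le_rfl

theorem IsNontrivial.moment_bernsteinSzego_of_le {j : ℕ} (hj : j ≤ n) (k : ℤ) (hk : |k| ≤ j) :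
    (hμ.bernsteinSzego n).moment k = μ.moment k :=
  hμ.moment_bernsteinSzego n (hk.trans (by exact_mod_cast hj))

theorem eval_zero_monicL_eq_zero {j : ℕ} (h : (μ.monicR (j + 1)).eval 0 = 0) :
    (μ.monicL (j + 1)).eval 0 = 0 := by
  have h1 := kappaL_mul_coeff_zero (μ.isMonicOrthR_monicR hμ j)
    (μ.isMonicOrthR_monicR hμ (j + 1)) (μ.isMonicOrthL_monicL hμ j)
    (μ.isMonicOrthL_monicL hμ (j + 1))
  rw [coeff_zero_eq_eval_zero, coeff_zero_eq_eval_zero, h, mul_zero] at h1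
  exact (hμ.isUnit_kappaR j).mul_left_eq_zero.1 h1.symm

end OpMeasure
end OperatorOPUC
end

theorem mainTheorem7 {H : Type*} [NormedAddCommGroup H] [InnerProductSpace ℂ H] [CompleteSpace H]
    (μ : OperatorOPUC.OpMeasure H) (hμ : μ.IsNontrivial) (n : ℕ) :
    (∀ z : Circle, IsUnit (OperatorOPUC.evalAt (μ.phiR n) z)) ∧
    ∃ ν : OperatorOPUC.OpMeasure H,
      ν.HasDensity (OperatorOPUC.bernsteinSzegoDensity μ n) ∧
      ν.IsNontrivial ∧
      ν Set.univ = μ Set.univ ∧ (μ.IsNormalized → ν.IsNormalized) ∧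
      (∀ j k : ℕ,
        ∫ z, star (OperatorOPUC.evalAt (ν.phiR j) z) * OperatorOPUC.bernsteinSzegoDensity μ n z *
          OperatorOPUC.evalAt (ν.phiR k) z ∂OperatorOPUC.circleMeasure = if j = k then 1 else 0) ∧
      (∀ j : ℕ, j ≤ n → ν.phiR j = μ.phiR j) ∧
      (∀ j : ℕ, n < j → ν.phiR j = Polynomial.X ^ (j - n) * μ.phiR n) ∧
      (∀ j : ℕ, j < n → ν.verblunskyR j = μ.verblunskyR j ∧ ν.verblunskyL j = μ.verblunskyL j) ∧
      (∀ j : ℕ, n ≤ j → ν.verblunskyR j = 0 ∧ ν.verblunskyL j = 0) := by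
  have huniv : (hμ.bernsteinSzego n) Set.univ = μ Set.univ := by
    rw [← OperatorOPUC.OpMeasure.moment_zero, ← OperatorOPUC.OpMeasure.moment_zero,
      hμ.moment_bernsteinSzego n (by simp)]
  have hν := hμ.isNontrivial_bernsteinSzego n
  refine ⟨hμ.isUnit_evalAt_phiR n, hμ.bernsteinSzego n,
    OperatorOPUC.OpMeasure.hasDensity_ofDensity _ _, hν, huniv, fun h => huniv.trans h,
    fun j k => ?_, fun j hj => ?_, fun j hj => ?_, fun j hj => ?_, fun j hj => ?_⟩
  · have hdeg : ∀ j i, j < i → ((hμ.bernsteinSzego n).phiR j).coeff i = 0 := fun j i hi => by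
      rw [OperatorOPUC.OpMeasure.coeff_phiR,
        (OperatorOPUC.OpMeasure.isMonicOrthR_monicR _ hν j).coeff_of_lt i hi, zero_mul]
    rw [OperatorOPUC.OpMeasure.integral_star_evalAt_mul (hμ.continuous_density n)
      (hμ.isPositive_density n) (hdeg j) (hdeg k)]
    exact hν.sum_star_phiR j k
  · have h := hμ.moment_bernsteinSzego_of_le n hj
    rw [OperatorOPUC.OpMeasure.phiR, OperatorOPUC.OpMeasure.phiR,
      OperatorOPUC.OpMeasure.monicR_congr h, OperatorOPUC.OpMeasure.kappaR_congr h]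
  · obtain ⟨h1, h2⟩ := hμ.monicR_bernsteinSzego n hj.le
    rw [OperatorOPUC.OpMeasure.phiR, OperatorOPUC.OpMeasure.phiR, h1, h2, mul_assoc]
  · have h := hμ.moment_bernsteinSzego_of_le n hj.le
    have h' := hμ.moment_bernsteinSzego_of_le n hj
    rw [OperatorOPUC.OpMeasure.verblunskyR, OperatorOPUC.OpMeasure.verblunskyR,
      OperatorOPUC.OpMeasure.verblunskyL, OperatorOPUC.OpMeasure.verblunskyL,
      OperatorOPUC.OpMeasure.monicR_congr h', OperatorOPUC.OpMeasure.monicL_congr h',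
      OperatorOPUC.OpMeasure.kappaR_congr h, OperatorOPUC.OpMeasure.kappaL_congr h]
    exact ⟨rfl, rfl⟩
  · have h0 : ((hμ.bernsteinSzego n).monicR (j + 1)).eval 0 = 0 := by
      rw [(hμ.monicR_bernsteinSzego n (by omega : n ≤ j + 1)).1, ← Polynomial.coeff_zero_eq_eval_zero,
        Polynomial.coeff_X_pow_mul', if_neg (by omega)]
    rw [OperatorOPUC.OpMeasure.verblunskyR, OperatorOPUC.OpMeasure.verblunskyL, h0,
      OperatorOPUC.OpMeasure.eval_zero_monicL_eq_zero hν h0]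
    simp
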